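/- **Setting.** Let $n\ge 2$ and let $p(x)=\sum_{j=0}^n p_jT_j(x)$ be a complex polynomial in the Chebyshev basis that is monic in this basis, i.e. $p_n=1$; $\|p\|$ denotes the Euclidean norm of the coefficient vector $(p_0,\dots,p_n)$. Its (scaled) colleague matrix is the $n\times n$ matrix $A=F+uv^*$, where $F$ is symmetric tridiagonal with zero diagonal and off-diagonal entries $\tfrac12,\dots,\tfrac12,\tfrac{\sqrt2}{2}$, $u=e_1$, and $v^*=-\tfrac12\,[\,p_{n-1},\,p_{n-2},\dots,p_1,\sqrt2\,p_0\,]$. **Arithmetic.** Computations follow the standard model of floating point arithmetic with unit roundoff $\epsilon_m$: every real operation and every square root is computed with relative error at most $\epsilon_m$; complex operations are carried out through real ones. **Algorithm.** The structured QR iteration stores only $u$, $v$ and the entries of the current Hermitian-plus-rank-one matrix $A$ on and below the diagonal (the diagonal $d$, the subdiagonal $\beta$, and the entries of the current bulges or of a deflation spike); the entries above the diagonal are defined by $A_{ij}=\overline{A_{ji}}-\overline{u_j}v_i+u_i\overline{v_j}$ for $j>i$. It starts from the stored data of the colleague matrix ($u=e_1$ exactly, the other entries with relative error at most $\tau\epsilon_m$)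 and performs a sequence of operations of the following kinds, each executed in floating point on the stored data, by computing the update of a diagonal block and discarding its part above the diagonal: * the similarity $A\mapsto G^*AG$, $u\mapsto G^*u$, $v\mapsto G^*v$, where $G$ is the Givens rotation of two consecutive indices $i,i+1$ that either starts a single-shift sweep (it is computed from $(d_i-\sigma,\beta_i)$ for a shift $\sigma\in\mathbb C$) or annihilates an entry $A_{i+1,l}$, $l<i$, against $A_{i,l}$; * the analogous similarity by two Givens rotations of the indices $i,i+1,i+2$ that either start a double-shift sweep (they are computed from the first column of $A^2-2\,\mathrm{Re}(\sigma)A+|\sigma|^2I$ on the active window) or annihilate $A_{i+1,l},A_{i+2,l}$, $l<i$; * deflation: a subdiagonal, bulge or spike entry of modulus at most $\tau\epsilon_m\|A\|_F$, with $A$ the current matrix, is set to $0$. The shifts and the order of the operations are arbitrary; this comprises the single-shift and the double-shift iteration, with or without aggressive early deflation, and their parallel versions. The iteration has converged when all entries below the diagonal are $0$; the computed roots are then the diagonal entries $d_1,\dots,d_n$ of the computed Schur form. **Theorem.** For every $a\in\mathbb N$ there is $k\in\mathbb N$, and for all $K\in\mathbb N$ and $\tau\in\mathbb R$ there is a constant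 $C>0$, with $k$ depending only on $a$ and $C$ only on $a,K,\tau$, such that the following holds for all $n\ge2$, all $p$ as above, all $\epsilon_m$ with $C\,n^k\,\|p\|\,\epsilon_m\le 1$, and all floating point arithmetics with unit roundoff $\epsilon_m$. If the structured QR iteration applied to the colleague matrix of $p$ converges within $K n^a$ operations, then the $n$ computed roots are, with multiplicity, exactly the roots of $p+\delta p$ for some $\delta p=\sum_{j=0}^{n-1}\delta p_j T_j$ (so that $p+\delta p$ is again monic in the Chebyshev basis) with $$\|\delta p\|\;\le\; C\,n^k\,\|p\|^2\,\epsilon_m ,$$ that is, $\|\delta p\|\lesssim\|p\|^2\epsilon_m$, where $\lesssim$ hides a polynomial in $n$ that does not depend on $p$. -/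

import Mathlib

open scoped ComplexConjugate

namespace StructuredQR

noncomputable section

/-! Polynomials in the Chebyshev basis and the colleague matrix. -/

/-- The polynomial `∑ j, p j * T j` of degree at most `n` with Chebyshev coefficients `p`. -/
def chebPoly {n : ℕ} (p : EuclideanSpace ℂ (Fin (n + 1))) : Polynomial ℂ :=
  ∑ j : Fin (n + 1), Polynomial.C (p j) * Polynomial.Chebyshev.T ℂ ((j : ℕ) : ℤ)

/-- The Hermitian part `F` of the colleague matrix: tridiagonal with zero diagonal, with
off-diagonal entries `1/2`, except the last one, which is `√2/2`. -/
def colleagueF (n : ℕ) : Matrix (Fin n) (Fin n) ℂ := fun i j =>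
  if (i : ℕ) + 1 = j ∨ (j : ℕ) + 1 = i then
    (if (i : ℕ) + 1 = n ∨ (j : ℕ) + 1 = n then ((Real.sqrt 2 / 2 : ℝ) : ℂ) else 1 / 2)
  else 0

/-- The vector `u = e₁` of the rank-one part `u v^*`. -/
def colleagueU (n : ℕ) : Fin n → ℂ := fun i => if (i : ℕ) = 0 then 1 else 0

/-- The vector `v` of the rank-one part, so that
`v^* = - (1 / (2 p_n)) [p_{n-1}, p_{n-2}, …, p_1, √2 p_0]`. -/
def colleagueV {n : ℕ} (p : EuclideanSpace ℂ (Fin (n + 1))) : Fin n → ℂ := fun j =>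
  conj (-((if (j : ℕ) + 1 = n then ((Real.sqrt 2 : ℝ) : ℂ) else 1)
    * p ⟨n - 1 - (j : ℕ), by omega⟩ / (2 * p (Fin.last n))))

/-- The (scaled) colleague matrix `F + u v^*`. -/
def colleague {n : ℕ} (p : EuclideanSpace ℂ (Fin (n + 1))) : Matrix (Fin n) (Fin n) ℂ :=
  fun i j => colleagueF n i j + colleagueU n i * conj (colleagueV p j)

/-! Floating point arithmetic. -/

/-- The standard model of floating point arithmetic with unit roundoff `ε`: the computed result of
a real operation `x ∘ y` (or of a square root) is `fl (x ∘ y)`, of relative error at most `ε`.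
Rounding to nearest in binary arithmetic with `t` bits, without overflow and underflow, is the
typical instance, with `ε = 2 ^ (-t)`. -/
def StandardModel (ε : ℝ) (fl : ℝ → ℝ) : Prop := ∀ x : ℝ, |fl x - x| ≤ ε * |x|

/-- Complex addition in floating point. -/
def fadd (fl : ℝ → ℝ) (z w : ℂ) : ℂ := ⟨fl (z.re + w.re), fl (z.im + w.im)⟩

/-- Complex subtraction in floating point. -/
def fsub (fl : ℝ → ℝ) (z w : ℂ) : ℂ := ⟨fl (z.re - w.re), fl (z.im - w.im)⟩

/-- Complex multiplication in floating point. -/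
def fmul (fl : ℝ → ℝ) (z w : ℂ) : ℂ :=
  ⟨fl (fl (z.re * w.re) - fl (z.im * w.im)), fl (fl (z.re * w.im) + fl (z.im * w.re))⟩

/-- Division of a complex number by a real one in floating point. -/
def fdiv (fl : ℝ → ℝ) (z : ℂ) (r : ℝ) : ℂ := ⟨fl (z.re / r), fl (z.im / r)⟩

/-- The squared modulus of a complex number in floating point. -/
def fnormSq (fl : ℝ → ℝ) (z : ℂ) : ℝ := fl (fl (z.re * z.re) + fl (z.im * z.im))

/-! Givens rotations. -/

/-- The data of a Givens rotation `G = [[c, -conj s], [s, conj c]]` with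
`G^* [a, b]ᵀ = [r, 0]ᵀ`. -/
structure Givens where
  c : ℂ
  s : ℂ
  r : ℝ

/-- The rotation computed in floating point from the vector `[a, b]ᵀ`:
`r = ‖[a, b]‖₂`, `c = a / r`, `s = b / r`. -/
def givens (fl : ℝ → ℝ) (a b : ℂ) : Givens :=
  if a = 0 ∧ b = 0 then ⟨1, 0, 0⟩
  else
    let r := fl (Real.sqrt (fl (fnormSq fl a + fnormSq fl b)))
    ⟨fdiv fl a r, fdiv fl b r, r⟩

variable {n : ℕ}

/-- `G^* w` in floating point, for the rotation `G` acting on the plane of the indices `i, j`. -/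
def rotVec (fl : ℝ → ℝ) (i j : Fin n) (G : Givens) (w : Fin n → ℂ) : Fin n → ℂ := fun k =>
  if k = i then fadd fl (fmul fl (conj G.c) (w i)) (fmul fl (conj G.s) (w j))
  else if k = j then fsub fl (fmul fl G.c (w j)) (fmul fl G.s (w i))
  else w k

/-- `G^* M` in floating point. -/
def rotRows (fl : ℝ → ℝ) (i j : Fin n) (G : Givens) (M : Matrix (Fin n) (Fin n) ℂ) :
    Matrix (Fin n) (Fin n) ℂ := fun k l => rotVec fl i j G (fun k' => M k' l) k

/-- `M G` in floating point. -/
def rotCols (fl : ℝ → ℝ) (i j : Fin n) (G : Givens) (M : Matrix (Fin n) (Fin n) ℂ) :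
    Matrix (Fin n) (Fin n) ℂ := fun k l =>
  if l = i then fadd fl (fmul fl (M k i) G.c) (fmul fl (M k j) G.s)
  else if l = j then fsub fl (fmul fl (M k j) (conj G.c)) (fmul fl (M k i) (conj G.s))
  else M k l

/-- `G^* M G` in floating point. -/
def rotSim (fl : ℝ → ℝ) (i j : Fin n) (G : Givens) (M : Matrix (Fin n) (Fin n) ℂ) :
    Matrix (Fin n) (Fin n) ℂ := rotCols fl i j G (rotRows fl i j G M)

/-! The structured representation. -/

/-- The data stored by the algorithm: the two vectors `u`, `v` of the rank-one part and the entries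
of the matrix on and below the diagonal. The diagonal of `L` is the generator `d` and its first
subdiagonal is the generator `β`; the entries below are zero, except for those of the bulges being
chased and for the spike met in aggressive early deflation. (Every floating point operation below
maps zeros to zeros, so that nothing is gained or lost by carrying the zero entries along.) The
entries of `L` above the diagonal are never read. -/
@[ext] structure State (n : ℕ) where
  L : Matrix (Fin n) (Fin n) ℂ
  u : Fin n → ℂ
  v : Fin n → ℂ

/-- The Hermitian-plus-rank-one matrix represented by the stored data. Above the diagonal,
`A i j = conj (A j i - u j * conj (v i)) + u i * conj (v j)`. -/
def State.matrix (S : State n) : Matrix (Fin n) (Fin n) ℂ := fun i j =>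
  if j ≤ i then S.L i j
  else conj (S.L j i) - conj (S.u j) * S.v i + S.u i * conj (S.v j)

/-- The entries of the represented matrix, those above the diagonal being recovered from the stored
data in floating point. -/
def State.entries (fl : ℝ → ℝ) (S : State n) : Matrix (Fin n) (Fin n) ℂ := fun i j =>
  if j ≤ i then S.L i j
  else fadd fl (fsub fl (conj (S.L j i)) (fmul fl (conj (S.u j)) (S.v i)))
    (fmul fl (S.u i) (conj (S.v j)))

/-- The part of a matrix on and below the diagonal. -/
def lowerPart (M : Matrix (Fin n) (Fin n) ℂ) : Matrix (Fin n) (Fin n) ℂ := fun i j =>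
  if j ≤ i then M i j else 0

/-- Overwrite one entry of a matrix. -/
def setEntry (M : Matrix (Fin n) (Fin n) ℂ) (i j : Fin n) (z : ℂ) : Matrix (Fin n) (Fin n) ℂ :=
  fun k l => if k = i ∧ l = j then z else M k l

/-- Structured update by one rotation acting on the indices `i, j = i + 1`: `A` is replaced by
`G^* A G`, and `u, v` by `G^* u, G^* v`. Only the entries on and below the diagonal are kept; they
depend on the stored data and on the single entry `A i (i + 1)` above the diagonal, so that the
update is that of a block of fixed size next to the diagonal. -/
def State.rotate (fl : ℝ → ℝ) (i j : Fin n) (G : Givens) (S : State n) : State n where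
  L := lowerPart (rotSim fl i j G (S.entries fl))
  u := rotVec fl i j G S.u
  v := rotVec fl i j G S.v

/-- Structured update by two rotations, as used in the double shift iteration: first `G₂`, acting
on the indices `j = i + 1, k = i + 2`, then `G₁`, acting on the indices `i, j`. -/
def State.rotate₂ (fl : ℝ → ℝ) (i j k : Fin n) (G₁ G₂ : Givens) (S : State n) : State n where
  L := lowerPart (rotSim fl i j G₁ (rotSim fl j k G₂ (S.entries fl)))
  u := rotVec fl i j G₁ (rotVec fl j k G₂ S.u)
  v := rotVec fl i j G₁ (rotVec fl j k G₂ S.v)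

/-! The elementary operations of the iteration. -/

/-- Start of a single shift sweep at row `i` (with `j = i + 1`) with shift `σ`: the rotation is
computed from the nonzero entries `d i - σ, β i` of the first column of `A - σ I`, where `A` stands
for the active window. -/
def State.startSingle (fl : ℝ → ℝ) (i j : Fin n) (σ : ℂ) (S : State n) : State n :=
  S.rotate fl i j (givens fl (fsub fl (S.L i i) σ) (S.L j i))

/-- One step of single shift bulge chasing: the rotation acting on the rows `i, j = i + 1`
annihilates the entry `(j, l)` against the entry `(i, l)`, where `l < i`. The two entries become
`r, 0`. -/
def State.chaseSingle (fl : ℝ → ℝ) (i j l : Fin n) (S : State n) : State n :=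
  let G := givens fl (S.L i l) (S.L j l)
  let S' := S.rotate fl i j G
  { S' with L := setEntry (setEntry S'.L i l (G.r : ℂ)) j l 0 }

/-- Start of a double shift sweep at row `i` (with `j = i + 1`, `k = i + 2`) with the shift
polynomial `ρ(z) = z² - 2 Re(σ) z + |σ|²`: the two rotations are computed from the nonzero
entries `x, y, z` of the first column of `ρ(A)`. -/
def State.startDouble (fl : ℝ → ℝ) (i j k : Fin n) (σ : ℂ) (S : State n) : State n :=
  let t : ℂ := (fl (2 * σ.re) : ℂ)
  let x := fadd fl
    (fsub fl
      (fadd fl (fmul fl (S.L i i) (S.L i i)) (fmul fl (S.entries fl i j) (S.L j i)))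
      (fmul fl t (S.L i i)))
    (fnormSq fl σ : ℂ)
  let y := fmul fl (S.L j i) (fsub fl (fadd fl (S.L i i) (S.L j j)) t)
  let z := fmul fl (S.L j i) (S.L k j)
  let G₂ := givens fl y z
  let G₁ := givens fl x (G₂.r : ℂ)
  S.rotate₂ fl i j k G₁ G₂

/-- One step of double shift bulge chasing: two rotations acting on the rows `i, j = i + 1,
k = i + 2` annihilate the entries `(k, l)` and `(j, l)`, where `l < i`. -/
def State.chaseDouble (fl : ℝ → ℝ) (i j k l : Fin n) (S : State n) : State n :=
  let G₂ := givens fl (S.L j l) (S.L k l)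
  let G₁ := givens fl (S.L i l) (G₂.r : ℂ)
  let S' := S.rotate₂ fl i j k G₁ G₂
  { S' with L := setEntry (setEntry (setEntry S'.L i l (G₁.r : ℂ)) j l 0) k l 0 }

/-- Deflation: an entry below the diagonal is set to zero. -/
def State.deflate (i j : Fin n) (S : State n) : State n :=
  { S with L := setEntry S.L i j 0 }

/-- An entry of size at most `τ ε ‖A‖`, with `A` the current matrix and `‖ ‖` the Frobenius norm,
is negligible. -/
def State.Negligible (τ ε : ℝ) (S : State n) (i j : Fin n) : Prop :=
  ‖S.L i j‖ ≤ τ * ε * Real.sqrt (∑ k, ∑ l, ‖S.matrix k l‖ ^ 2)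

/-- One elementary operation of the structured QR iteration in floating point. Every version of the
iteration is a sequence of these. A single shift sweep on the window `lo, …, hi` is `startSingle`
at `lo`, followed by `chaseSingle` at the rows `i, i + 1` and column `i - 1` for
`i = lo + 1, …, hi - 1`; a double shift sweep is `startDouble` at `lo`, followed by `chaseDouble` at
the rows `i, i + 1, i + 2` and column `i - 1` for `i = lo + 1, …, hi - 2`, and one `chaseSingle`.
In aggressive early deflation the sweeps act on a trailing window, without the entry to its left
being zero, negligible entries of the resulting spike are set to zero by `deflate`, and the
Hessenberg form is restored by `chaseSingle`, on the column `l` of the spike from the bottom, and on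
the bulges. In the parallel version the operations of several sweeps are interleaved. The shifts
`σ` are arbitrary, so that every shift strategy is covered. -/
inductive Step (τ ε : ℝ) (fl : ℝ → ℝ) : State n → State n → Prop
  | startSingle (S : State n) (i j : Fin n) (σ : ℂ) (hj : (j : ℕ) = i + 1) :
      Step τ ε fl S (S.startSingle fl i j σ)
  | chaseSingle (S : State n) (i j l : Fin n) (hj : (j : ℕ) = i + 1) (hl : l < i) :
      Step τ ε fl S (S.chaseSingle fl i j l)
  | startDouble (S : State n) (i j k : Fin n) (σ : ℂ) (hj : (j : ℕ) = i + 1)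
      (hk : (k : ℕ) = i + 2) : Step τ ε fl S (S.startDouble fl i j k σ)
  | chaseDouble (S : State n) (i j k l : Fin n) (hj : (j : ℕ) = i + 1) (hk : (k : ℕ) = i + 2)
      (hl : l < i) : Step τ ε fl S (S.chaseDouble fl i j k l)
  | deflate (S : State n) (i j : Fin n) (hij : j < i) (h : S.Negligible τ ε i j) :
      Step τ ε fl S (S.deflate i j)

/-- `Run τ ε fl N S S'`: the structured QR iteration leads from `S` to `S'` in `N` operations. -/
inductive Run (τ ε : ℝ) (fl : ℝ → ℝ) : ℕ → State n → State n → Prop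
  | refl (S : State n) : Run τ ε fl 0 S S
  | tail {N : ℕ} {S S' S'' : State n} (h : Run τ ε fl N S S') (h' : Step τ ε fl S' S'') :
      Run τ ε fl (N + 1) S S''

/-- The state stores the generators of the colleague matrix of `p`, each formed in floating point
with a relative error of at most `τ ε`. -/
def State.Represents (τ ε : ℝ) (p : EuclideanSpace ℂ (Fin (n + 1))) (S : State n) : Prop :=
  (∀ i j : Fin n, j ≤ i → ‖S.L i j - colleague p i j‖ ≤ τ * ε * ‖colleague p i j‖) ∧
  (∀ i : Fin n, S.u i = colleagueU n i) ∧
  (∀ i : Fin n, ‖S.v i - colleagueV p i‖ ≤ τ * ε * ‖colleagueV p i‖)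

/-- The iteration has converged: every entry below the diagonal has been deflated, and the
represented matrix is a (computed) Schur form. -/
def State.Converged (S : State n) : Prop := ∀ i j : Fin n, j < i → S.L i j = 0

/-- The computed eigenvalues: the diagonal of the computed Schur form. -/
def State.eigenvalues (S : State n) : Multiset ℂ :=
  (Finset.univ : Finset (Fin n)).val.map fun i => S.L i i

end

end StructuredQR

namespace StructuredQR

open scoped ComplexConjugate Matrix Matrix.Norms.Frobenius

/-! ### Rounding errors of complex arithmetic and of computed rotations -/

section FloatingPoint

variable {ε : ℝ} {fl : ℝ → ℝ}

/-! The stored data determine `A = H + u v^*`. Since the entries above the diagonal are defined by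
symmetry, `H` is exactly Hermitian off the diagonal after every operation, whatever the rounding
errors. The backward error therefore splits: the converged form is unitarily similar to `(F + E) + U
V^*`, where `U - u` is of order `ε`, while `V - v` and `E` are of order `‖p‖ ε`, up to powers of `n`
and of the number of operations.

One operation: a computed rotation is near an exactly unitary one that annihilates the same entry,
so the new lower triangle, `u` and `v` are those of an exact unitary similarity up to relative
errors `O(ε)` (`exists_givens_near`, `Step.exists_nearSimilar`). Many operations: the upper triangle
is recreated by reflection, which costs the skew part of `H` at each operation. That part is
confined to the diagonal and grows linearly in the number of operations, so `E` grows quadratically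
and not exponentially (`State.Tracks.of_nearSimilar`, `Run.tracksAfter`).

From matrices to polynomials: the identities `T_n(x) = 2^(n-1) det(x - F)` and `p(x) = T_n(x) (1 -
v^* (x - F)⁻¹ u)` (`two_pow_mul_det_scalar_sub_colleagueF`, `eval_chebPoly_eq`) express `p` through
the data. The same expression with perturbed data is `2^(n-1)` times the characteristic polynomial
of the computed form. It is affine in the rank-one part, so no high power of `‖p‖` appears. The
error is of order `‖p‖ ‖E‖ + ‖V - v‖ + ‖p‖ ‖U - u‖` (`norm_charpoly_perturbation_le`), hence of
order `‖p‖² ε`.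

The comparison is made on the ellipse `x = (z + z⁻¹) / 2`, `|z| = 1 + 1/n`. This ellipse is at
distance at least `1 / (4 n²)` from `[-1, 1]`, which contains the numerical range of `F`, so the
resolvent is polynomially bounded; on it `T_n` is bounded by a constant. Chebyshev coefficients are
recovered from values on the ellipse by a discrete Fourier sum (`norm_apply_le_of_eval_joukowski`),
which turns the bound on values into a bound on `δp`. -/

theorem StandardModel.nonneg (h : StandardModel ε fl) : 0 ≤ ε := by
  have := h 1
  simp only [abs_one, mul_one] at this
  exact (abs_nonneg _).trans this

theorem norm_round_sub_le (h : StandardModel ε fl) (x y : ℝ) :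
    ‖(⟨fl x, fl y⟩ : ℂ) - ⟨x, y⟩‖ ≤ ε * ‖(⟨x, y⟩ : ℂ)‖ := by
  have h0 := h.nonneg
  refine abs_le_of_sq_le_sq' ?_ (by positivity) |>.2
  rw [mul_pow, Complex.sq_norm, Complex.sq_norm, Complex.normSq_apply, Complex.normSq_apply]
  simp only [Complex.sub_re, Complex.sub_im]
  have hx := pow_le_pow_left₀ (abs_nonneg _) (h x) 2
  have hy := pow_le_pow_left₀ (abs_nonneg _) (h y) 2
  rw [mul_pow, sq_abs, sq_abs] at hx hy
  nlinarith

theorem norm_fadd_sub_le (h : StandardModel ε fl) (z w : ℂ) :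
    ‖fadd fl z w - (z + w)‖ ≤ ε * ‖z + w‖ :=
  norm_round_sub_le h (z.re + w.re) (z.im + w.im)

theorem norm_fsub_sub_le (h : StandardModel ε fl) (z w : ℂ) :
    ‖fsub fl z w - (z - w)‖ ≤ ε * ‖z - w‖ :=
  norm_round_sub_le h (z.re - w.re) (z.im - w.im)

theorem norm_fdiv_sub_le (h : StandardModel ε fl) (z : ℂ) (r : ℝ) :
    ‖fdiv fl z r - z / r‖ ≤ ε * ‖z / r‖ := by
  have := norm_round_sub_le h (z.re / r) (z.im / r)
  have e : z / r = ⟨z.re / r, z.im / r⟩ := by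
    apply Complex.ext <;> simp [Complex.div_ofReal_re, Complex.div_ofReal_im]
  rw [e]; exact this

theorem abs_round_add_sub_le (h : StandardModel ε fl) (hε : ε ≤ 1) (a b : ℝ) :
    |fl (fl a + fl b) - (a + b)| ≤ 3 * ε * (|a| + |b|) := by
  have h0 := h.nonneg
  have ha := h a
  have hb := h b
  have h1 := h (fl a + fl b)
  have e : fl (fl a + fl b) - (a + b)
      = (fl (fl a + fl b) - (fl a + fl b)) + ((fl a - a) + (fl b - b)) := by ring
  have h2 : |fl a + fl b| ≤ (1 + ε) * (|a| + |b|) := by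
    have e2 : fl a + fl b = (a + b) + ((fl a - a) + (fl b - b)) := by ring
    rw [e2]
    have := abs_add_le (a + b) ((fl a - a) + (fl b - b))
    have := abs_add_le a b
    have := abs_add_le (fl a - a) (fl b - b)
    nlinarith
  rw [e]
  have := abs_add_le (fl (fl a + fl b) - (fl a + fl b)) ((fl a - a) + (fl b - b))
  have := abs_add_le (fl a - a) (fl b - b)
  have h3 := mul_le_mul_of_nonneg_left h2 h0
  have : ε * ((1 + ε) * (|a| + |b|)) ≤ ε * (2 * (|a| + |b|)) := by gcongr; linarith
  nlinarith

theorem abs_round_sub_sub_le (h : StandardModel ε fl) (hε : ε ≤ 1) (a b : ℝ) :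
    |fl (fl a - fl b) - (a - b)| ≤ 3 * ε * (|a| + |b|) := by
  have h0 := h.nonneg
  have ha := h a
  have hb := h b
  have h1 := h (fl a - fl b)
  have e : fl (fl a - fl b) - (a - b)
      = (fl (fl a - fl b) - (fl a - fl b)) + ((fl a - a) - (fl b - b)) := by ring
  have h2 : |fl a - fl b| ≤ (1 + ε) * (|a| + |b|) := by
    have e2 : fl a - fl b = (a - b) + ((fl a - a) - (fl b - b)) := by ring
    rw [e2]
    have := abs_add_le (a - b) ((fl a - a) - (fl b - b))
    have := abs_sub a b
    have := abs_sub (fl a - a) (fl b - b)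
    nlinarith
  rw [e]
  have := abs_add_le (fl (fl a - fl b) - (fl a - fl b)) ((fl a - a) - (fl b - b))
  have := abs_sub (fl a - a) (fl b - b)
  have h3 := mul_le_mul_of_nonneg_left h2 h0
  have : ε * ((1 + ε) * (|a| + |b|)) ≤ ε * (2 * (|a| + |b|)) := by gcongr; linarith
  nlinarith

theorem norm_fmul_sub_le (h : StandardModel ε fl) (hε : ε ≤ 1) (z w : ℂ) :
    ‖fmul fl z w - z * w‖ ≤ 12 * ε * (‖z‖ * ‖w‖) := by
  have h0 := h.nonneg
  have key : ∀ a b c d : ℝ, |a| ≤ ‖z‖ → |b| ≤ ‖w‖ → |c| ≤ ‖z‖ → |d| ≤ ‖w‖ →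
      3 * ε * (|a * b| + |c * d|) ≤ 6 * ε * (‖z‖ * ‖w‖) := by
    intro a b c d ha hb hc hd
    have h1 : |a * b| ≤ ‖z‖ * ‖w‖ := by rw [abs_mul]; gcongr
    have h2 : |c * d| ≤ ‖z‖ * ‖w‖ := by rw [abs_mul]; gcongr
    nlinarith
  have hre : |(fmul fl z w - z * w).re| ≤ 6 * ε * (‖z‖ * ‖w‖) :=
    (abs_round_sub_sub_le h hε (z.re * w.re) (z.im * w.im)).trans
      (key _ _ _ _ (Complex.abs_re_le_norm z) (Complex.abs_re_le_norm w)
        (Complex.abs_im_le_norm z) (Complex.abs_im_le_norm w))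
  have him : |(fmul fl z w - z * w).im| ≤ 6 * ε * (‖z‖ * ‖w‖) :=
    (abs_round_add_sub_le h hε (z.re * w.im) (z.im * w.re)).trans
      (key _ _ _ _ (Complex.abs_re_le_norm z) (Complex.abs_im_le_norm w)
        (Complex.abs_im_le_norm z) (Complex.abs_re_le_norm w))
  have := Complex.norm_le_abs_re_add_abs_im (fmul fl z w - z * w)
  linarith

theorem abs_fnormSq_sub_le (h : StandardModel ε fl) (hε : ε ≤ 1) (z : ℂ) :
    |fnormSq fl z - ‖z‖ ^ 2| ≤ 3 * ε * ‖z‖ ^ 2 := by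
  have := abs_round_add_sub_le h hε (z.re * z.re) (z.im * z.im)
  rw [abs_mul_self, abs_mul_self] at this
  rw [Complex.sq_norm, Complex.normSq_apply]
  exact this

theorem norm_le_of_norm_sub_le {z w : ℂ} {e : ℝ} (h : ‖z - w‖ ≤ e) : ‖z‖ ≤ ‖w‖ + e := by
  have := norm_le_norm_add_norm_sub' z w
  linarith

/-- The rounding error of `a * x`, with perturbed `a` and `x`. -/
theorem norm_fmul_sub_mul_le (h : StandardModel ε fl) (hε : ε ≤ 1 / 100)
    {a x a' x' : ℂ} {e m : ℝ} (ha : ‖a - a'‖ ≤ 10 * ε) (ha' : ‖a'‖ ≤ 1) (hx : ‖x - x'‖ ≤ e)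
    (hx' : ‖x'‖ ≤ m) : ‖fmul fl a x - a' * x'‖ ≤ 5 / 4 * e + 30 * ε * m := by
  have h0 := h.nonneg
  have he : 0 ≤ e := (norm_nonneg _).trans hx
  have hm : 0 ≤ m := (norm_nonneg _).trans hx'
  have h1 : ‖a‖ ≤ 1 + 10 * ε := (norm_le_of_norm_sub_le ha).trans (by linarith)
  have h2 : ‖x‖ ≤ m + e := (norm_le_of_norm_sub_le hx).trans (by linarith)
  have h5 := norm_fmul_sub_le h (by linarith) a x
  have h6 : ‖a‖ * ‖x‖ ≤ (1 + 10 * ε) * (m + e) := by gcongr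
  have e1 : fmul fl a x - a' * x' = (fmul fl a x - a * x) + ((a - a') * x + a' * (x - x')) := by
    ring
  rw [e1]
  have h7 : ‖(a - a') * x‖ ≤ 10 * ε * (m + e) := by rw [norm_mul]; gcongr
  have h8 : ‖a' * (x - x')‖ ≤ 1 * e := by rw [norm_mul]; gcongr
  have h9 := norm_add_le (fmul fl a x - a * x) ((a - a') * x + a' * (x - x'))
  have h10 := norm_add_le ((a - a') * x) (a' * (x - x'))
  have h11 : 12 * ε * (‖a‖ * ‖x‖) ≤ 12 * ε * ((1 + 10 * ε) * (m + e)) := by gcongr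
  have h12 : 12 * ε * ((1 + 10 * ε) * (m + e)) ≤ 12 * ε * (11 / 10 * (m + e)) := by
    gcongr; linarith
  nlinarith [mul_le_mul_of_nonneg_right hε he]

theorem norm_fadd_sub_add_le (h : StandardModel ε fl) (hε : ε ≤ 1 / 100)
    {z w z' w' : ℂ} {e m : ℝ} (he : 0 ≤ e) (hz : ‖z - z'‖ ≤ 5 / 4 * e + 30 * ε * m)
    (hw : ‖w - w'‖ ≤ 5 / 4 * e + 30 * ε * m) (hz' : ‖z'‖ ≤ m) (hw' : ‖w'‖ ≤ m) :
    ‖fadd fl z w - (z' + w')‖ ≤ 3 * e + 100 * ε * m := by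
  have h0 := h.nonneg
  have hm : 0 ≤ m := (norm_nonneg _).trans hz'
  have h3 := norm_fadd_sub_le h z w
  have h4 : ‖(z + w) - (z' + w')‖ ≤ 5 / 2 * e + 60 * ε * m := by
    rw [add_sub_add_comm]
    have := norm_add_le (z - z') (w - w')
    linarith
  have h5 := norm_add_le z' w'
  have h6 := norm_le_of_norm_sub_le h4
  have h7 := norm_sub_le_norm_sub_add_norm_sub (fadd fl z w) (z + w) (z' + w')
  have h8 : ε * ‖z + w‖ ≤ ε * (2 * m + (5 / 2 * e + 60 * ε * m)) := by
    gcongr; linarith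
  nlinarith [mul_le_mul_of_nonneg_right hε he, mul_le_mul_of_nonneg_right hε (mul_nonneg h0 hm)]

/-- The rounding error of `a * x + b * y`, with perturbed `a` and `b` as well as `x` and `y`. -/
theorem norm_fadd_fmul_sub_le (h : StandardModel ε fl) (hε : ε ≤ 1 / 100)
    {a b x y a' b' x' y' : ℂ} {e m : ℝ} (ha : ‖a - a'‖ ≤ 10 * ε) (hb : ‖b - b'‖ ≤ 10 * ε)
    (ha' : ‖a'‖ ≤ 1) (hb' : ‖b'‖ ≤ 1) (hx : ‖x - x'‖ ≤ e) (hy : ‖y - y'‖ ≤ e)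
    (hx' : ‖x'‖ ≤ m) (hy' : ‖y'‖ ≤ m) :
    ‖fadd fl (fmul fl a x) (fmul fl b y) - (a' * x' + b' * y')‖ ≤ 3 * e + 100 * ε * m :=
  norm_fadd_sub_add_le h hε ((norm_nonneg _).trans hx)
    (norm_fmul_sub_mul_le h hε ha ha' hx hx') (norm_fmul_sub_mul_le h hε hb hb' hy hy')
    (by rw [norm_mul]; exact (mul_le_of_le_one_left (norm_nonneg _) ha').trans hx')
    (by rw [norm_mul]; exact (mul_le_of_le_one_left (norm_nonneg _) hb').trans hy')

theorem norm_fsub_fmul_sub_le (h : StandardModel ε fl) (hε : ε ≤ 1 / 100)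
    {a b x y a' b' x' y' : ℂ} {e m : ℝ} (ha : ‖a - a'‖ ≤ 10 * ε) (hb : ‖b - b'‖ ≤ 10 * ε)
    (ha' : ‖a'‖ ≤ 1) (hb' : ‖b'‖ ≤ 1) (hx : ‖x - x'‖ ≤ e) (hy : ‖y - y'‖ ≤ e)
    (hx' : ‖x'‖ ≤ m) (hy' : ‖y'‖ ≤ m) :
    ‖fsub fl (fmul fl a x) (fmul fl b y) - (a' * x' - b' * y')‖ ≤ 3 * e + 100 * ε * m := by
  have e1 : ∀ z w : ℂ, fsub fl z w = fadd fl z (-w) := fun z w => by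
    simp [fsub, fadd, sub_eq_add_neg]
  rw [e1, sub_eq_add_neg (a' * x')]
  refine norm_fadd_sub_add_le h hε ((norm_nonneg _).trans hx)
    (norm_fmul_sub_mul_le h hε ha ha' hx hx') ?_
    (by rw [norm_mul]; exact (mul_le_of_le_one_left (norm_nonneg _) ha').trans hx')
    (by rw [norm_neg, norm_mul]; exact (mul_le_of_le_one_left (norm_nonneg _) hb').trans hy')
  rw [neg_sub_neg, norm_sub_rev]
  exact norm_fmul_sub_mul_le h hε hb hb' hy hy'

/-- The computed radius of a rotation. -/
theorem abs_round_sqrt_sub_le (h : StandardModel ε fl) (hε : ε ≤ 1 / 100) (a b : ℂ) :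
    |fl (Real.sqrt (fl (fnormSq fl a + fnormSq fl b))) - Real.sqrt (‖a‖ ^ 2 + ‖b‖ ^ 2)|
      ≤ 7 * ε * Real.sqrt (‖a‖ ^ 2 + ‖b‖ ^ 2) := by
  have h0 := h.nonneg
  set T := ‖a‖ ^ 2 + ‖b‖ ^ 2 with hT
  have hT0 : 0 ≤ T := by positivity
  set w := fl (fnormSq fl a + fnormSq fl b)
  have h1 : |fnormSq fl a + fnormSq fl b - T| ≤ 3 * ε * T := by
    have e : fnormSq fl a + fnormSq fl b - T
      = (fnormSq fl a - ‖a‖ ^ 2) + (fnormSq fl b - ‖b‖ ^ 2) := by rw [hT]; ring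
    rw [e]
    have := abs_add_le (fnormSq fl a - ‖a‖ ^ 2) (fnormSq fl b - ‖b‖ ^ 2)
    have := abs_fnormSq_sub_le h (by linarith) a
    have := abs_fnormSq_sub_le h (by linarith) b
    rw [hT]; linarith
  have h2 : |w - T| ≤ 5 * ε * T := by
    have h3 := h (fnormSq fl a + fnormSq fl b)
    have h4 : |fnormSq fl a + fnormSq fl b| ≤ (1 + 3 * ε) * T := by
      have := abs_sub_abs_le_abs_sub (fnormSq fl a + fnormSq fl b) T
      rw [abs_of_nonneg hT0] at this
      linarith
    have h5 := abs_sub_le w (fnormSq fl a + fnormSq fl b) T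
    have h6 := mul_le_mul_of_nonneg_left h4 h0
    nlinarith [mul_le_mul_of_nonneg_right hε (mul_nonneg h0 hT0)]
  have hw : 0 ≤ w := by
    have := (abs_le.mp h2).1
    nlinarith
  have hs0 := Real.sqrt_nonneg T
  have h3 : |Real.sqrt w - Real.sqrt T| ≤ 5 * ε * Real.sqrt T := by
    rcases hs0.eq_or_lt with hs | hs
    · have : T = 0 := (Real.sqrt_eq_zero hT0).mp hs.symm
      rw [this] at h2 ⊢
      have : w = 0 := by simpa using h2
      simp [this]
    -- Dividing the difference of squares by `√w + √T ≥ √T` shows that the square root does not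
    -- amplify the relative error.
    · have e : w - T = (Real.sqrt w - Real.sqrt T) * (Real.sqrt w + Real.sqrt T) := by
        linear_combination -Real.mul_self_sqrt hw + Real.mul_self_sqrt hT0
      have h4 : |Real.sqrt w - Real.sqrt T| * Real.sqrt T ≤ (5 * ε * Real.sqrt T) * Real.sqrt T := by
        calc |Real.sqrt w - Real.sqrt T| * Real.sqrt T
            ≤ |Real.sqrt w - Real.sqrt T| * |Real.sqrt w + Real.sqrt T| := by
              gcongr
              exact (le_add_of_nonneg_left (Real.sqrt_nonneg _)).trans (le_abs_self _)
          _ = |w - T| := by rw [← abs_mul, ← e]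
          _ ≤ 5 * ε * T := h2
          _ = (5 * ε * Real.sqrt T) * Real.sqrt T := by
              linear_combination (-5 * ε) * Real.mul_self_sqrt hT0
      exact le_of_mul_le_mul_right h4 hs
  have h4 := h (Real.sqrt w)
  have h5 := abs_sub_le (fl (Real.sqrt w)) (Real.sqrt w) (Real.sqrt T)
  have h6 : |Real.sqrt w| ≤ (1 + 5 * ε) * Real.sqrt T := by
    have := abs_sub_abs_le_abs_sub (Real.sqrt w) (Real.sqrt T)
    rw [abs_of_nonneg hs0] at this
    linarith
  have h7 := mul_le_mul_of_nonneg_left h6 h0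
  nlinarith [mul_le_mul_of_nonneg_right hε (mul_nonneg h0 hs0)]

theorem norm_fdiv_sub_div_le (h : StandardModel ε fl) (hε : ε ≤ 1 / 100) {a : ℂ} {r s : ℝ}
    (hs : 0 < s) (ha : ‖a‖ ≤ s) (hr : |r - s| ≤ 7 * ε * s) :
    ‖fdiv fl a r - a / s‖ ≤ 10 * ε := by
  have h0 := h.nonneg
  have hr1 : (93 / 100) * s ≤ r := by
    have := (abs_le.mp hr).1
    nlinarith
  have hr0 : 0 < r := lt_of_lt_of_le (by positivity) hr1
  have h1 := norm_fdiv_sub_le h a r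
  have h2 : ‖a / (r : ℂ)‖ ≤ 100 / 93 := by
    rw [norm_div, Complex.norm_real, Real.norm_of_nonneg hr0.le, div_le_iff₀ hr0]
    linarith
  have h3 : ‖a / (r : ℂ) - a / s‖ ≤ 8 * ε := by
    have hrc : (r : ℂ) ≠ 0 := by exact_mod_cast hr0.ne'
    have hsc : (s : ℂ) ≠ 0 := by exact_mod_cast hs.ne'
    have e : a / (r : ℂ) - a / s = a / (r : ℂ) * (((s - r : ℝ) : ℂ) / s) := by
      push_cast; field_simp
    rw [e, norm_mul, norm_div (((s - r : ℝ) : ℂ)), Complex.norm_real, Complex.norm_real,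
      Real.norm_of_nonneg hs.le, Real.norm_eq_abs, abs_sub_comm]
    calc ‖a / (r : ℂ)‖ * (|r - s| / s) ≤ 100 / 93 * (7 * ε) := by
          gcongr
          rw [div_le_iff₀ hs]; exact hr
      _ ≤ 8 * ε := by nlinarith
  have h4 := norm_sub_le_norm_sub_add_norm_sub (fdiv fl a r) (a / (r : ℂ)) (a / s)
  nlinarith

/-- The computed rotation is close to one which is exactly unitary and annihilates the second
entry exactly. -/
theorem exists_givens_near (h : StandardModel ε fl) (hε : ε ≤ 1 / 100) (a b : ℂ) :
    ∃ c s : ℂ, conj c * c + conj s * s = 1 ∧ ‖c‖ ≤ 1 ∧ ‖s‖ ≤ 1 ∧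
      ‖(givens fl a b).c - c‖ ≤ 10 * ε ∧ ‖(givens fl a b).s - s‖ ≤ 10 * ε ∧
      ‖((givens fl a b).r : ℂ) - (conj c * a + conj s * b)‖ ≤ 14 * ε * (‖a‖ + ‖b‖) ∧
      c * b - s * a = 0 := by
  have h0 := h.nonneg
  by_cases hab : a = 0 ∧ b = 0
  -- The zero vector: the computed rotation is the identity, without error.
  · refine ⟨1, 0, ?_⟩
    simp [givens, hab, h0]
  set T := ‖a‖ ^ 2 + ‖b‖ ^ 2 with hT
  have hT0 : 0 < T := by
    rcases not_and_or.mp hab with ha | hb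
    · have := norm_pos_iff.mpr ha
      positivity
    · have := norm_pos_iff.mpr hb
      positivity
  set ρ := Real.sqrt T with hρ
  have hρ0 : 0 < ρ := Real.sqrt_pos.mpr hT0
  have hρc : (ρ : ℂ) ≠ 0 := by exact_mod_cast hρ0.ne'
  have hρ2 : (ρ : ℂ) * ρ = conj a * a + conj b * b := by
    rw [← Complex.ofReal_mul, Real.mul_self_sqrt hT0.le, Complex.conj_mul', Complex.conj_mul', hT]
    push_cast; rfl
  have ha : ‖a‖ ≤ ρ := Real.le_sqrt_of_sq_le (by rw [hT]; nlinarith [sq_nonneg ‖b‖])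
  have hb : ‖b‖ ≤ ρ := Real.le_sqrt_of_sq_le (by rw [hT]; nlinarith [sq_nonneg ‖a‖])
  have hab' : ρ ≤ ‖a‖ + ‖b‖ := by
    rw [hρ, Real.sqrt_le_left (by positivity), hT]
    nlinarith [mul_nonneg (norm_nonneg a) (norm_nonneg b)]
  have hr := abs_round_sqrt_sub_le h hε a b
  have hg : givens fl a b = ⟨fdiv fl a (fl (Real.sqrt (fl (fnormSq fl a + fnormSq fl b)))),
    fdiv fl b (fl (Real.sqrt (fl (fnormSq fl a + fnormSq fl b)))),
    fl (Real.sqrt (fl (fnormSq fl a + fnormSq fl b)))⟩ := by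
    simp [givens, hab]
  rw [hg]
  have nle : ∀ z : ℂ, ‖z‖ ≤ ρ → ‖z / (ρ : ℂ)‖ ≤ 1 := fun z hz => by
    rw [norm_div, Complex.norm_real, Real.norm_of_nonneg hρ0.le]
    exact div_le_one_of_le₀ hz hρ0.le
  -- Dividing by the exact norm `ρ` instead of the rounded radius makes the rotation exactly
  -- unitary; the rounding is moved entirely into the distance between the two rotations.
  refine ⟨a / ρ, b / ρ, ?_, nle a ha, nle b hb, norm_fdiv_sub_div_le h hε hρ0 ha hr,
    norm_fdiv_sub_div_le h hε hρ0 hb hr, ?_, ?_⟩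
  · simp only [map_div₀, Complex.conj_ofReal]
    field_simp
    rw [sq, hρ2]
  · have e : conj (a / (ρ : ℂ)) * a + conj (b / (ρ : ℂ)) * b = (ρ : ℂ) := by
      simp only [map_div₀, Complex.conj_ofReal]
      field_simp
      rw [sq, hρ2]
    rw [e, ← Complex.ofReal_sub, Complex.norm_real, Real.norm_eq_abs]
    refine hr.trans ?_
    nlinarith [mul_le_mul_of_nonneg_left hab' h0]
  · field_simp
    ring

end FloatingPoint

/-! ### Frobenius norm: entrywise bounds and unitary invariance -/

section Frobenius

variable {m n : Type*} [Fintype m] [Fintype n]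

theorem frobenius_norm_sq (M : Matrix m n ℂ) : ‖M‖ ^ 2 = ∑ i, ∑ j, ‖M i j‖ ^ 2 := by
  rw [Matrix.frobenius_norm_def, ← Real.sqrt_eq_rpow, Real.sq_sqrt (by positivity)]
  simp

theorem norm_entry_le (M : Matrix m n ℂ) (i : m) (j : n) : ‖M i j‖ ≤ ‖M‖ := by
  refine abs_le_of_sq_le_sq' ?_ (norm_nonneg _) |>.2
  rw [frobenius_norm_sq]
  calc ‖M i j‖ ^ 2 ≤ ∑ j, ‖M i j‖ ^ 2 :=
        Finset.single_le_sum (f := fun j => ‖M i j‖ ^ 2) (fun _ _ => by positivity)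
          (Finset.mem_univ j)
    _ ≤ ∑ i, ∑ j, ‖M i j‖ ^ 2 :=
        Finset.single_le_sum (f := fun i => ∑ j, ‖M i j‖ ^ 2) (fun _ _ => by positivity)
          (Finset.mem_univ i)

theorem frobenius_norm_mono {M N : Matrix m n ℂ} (h : ∀ i j, ‖M i j‖ ≤ ‖N i j‖) : ‖M‖ ≤ ‖N‖ := by
  refine abs_le_of_sq_le_sq' ?_ (norm_nonneg _) |>.2
  rw [frobenius_norm_sq, frobenius_norm_sq]
  gcongr
  exact h _ _

theorem frobenius_norm_le_of_entries {M : Matrix m n ℂ} {e : ℝ} (h : ∀ i j, ‖M i j‖ ≤ e) :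
    ‖M‖ ^ 2 ≤ Fintype.card m * Fintype.card n * e ^ 2 := by
  rw [frobenius_norm_sq]
  calc ∑ i, ∑ j, ‖M i j‖ ^ 2 ≤ ∑ _i : m, ∑ _j : n, e ^ 2 := by gcongr; exact h _ _
    _ = _ := by simp [mul_assoc]

theorem norm_le_of_entries_square {n : ℕ} {M : Matrix (Fin n) (Fin n) ℂ} {e : ℝ} (he : 0 ≤ e)
    (h : ∀ i j, ‖M i j‖ ≤ e) : ‖M‖ ≤ n * e := by
  refine abs_le_of_sq_le_sq' ?_ (by positivity) |>.2
  have := frobenius_norm_le_of_entries h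
  simp only [Fintype.card_fin] at this
  nlinarith

theorem norm_le_of_entries_column {n : ℕ} {M : Matrix (Fin n) (Fin 1) ℂ} {e : ℝ} (he : 0 ≤ e)
    (h : ∀ i j, ‖M i j‖ ≤ e) : ‖M‖ ≤ n * e := by
  refine abs_le_of_sq_le_sq' ?_ (by positivity) |>.2
  have h1 := frobenius_norm_le_of_entries h
  simp only [Fintype.card_fin, Nat.cast_one, mul_one] at h1
  rw [mul_pow]
  refine h1.trans ?_
  gcongr
  exact_mod_cast Nat.le_self_pow two_ne_zero n

theorem frobenius_norm_sq_eq_trace (M : Matrix m n ℂ) : ((‖M‖ ^ 2 : ℝ) : ℂ) = (Mᴴ * M).trace := by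
  rw [frobenius_norm_sq, Matrix.trace, Finset.sum_comm]
  push_cast
  refine Finset.sum_congr rfl fun i _ => ?_
  simp only [Matrix.diag_apply, Matrix.mul_apply, Matrix.conjTranspose_apply]
  refine Finset.sum_congr rfl fun j _ => ?_
  rw [← Complex.conj_mul']; rfl

variable [DecidableEq m]

theorem norm_mul_of_unitary {Q : Matrix m m ℂ} (hQ : Qᴴ * Q = 1) (M : Matrix m n ℂ) :
    ‖Q * M‖ = ‖M‖ := by
  have : ‖Q * M‖ ^ 2 = ‖M‖ ^ 2 := by
    have h : ((‖Q * M‖ ^ 2 : ℝ) : ℂ) = ((‖M‖ ^ 2 : ℝ) : ℂ) := by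
      rw [frobenius_norm_sq_eq_trace, frobenius_norm_sq_eq_trace, Matrix.conjTranspose_mul,
        Matrix.mul_assoc, ← Matrix.mul_assoc Qᴴ, hQ, Matrix.one_mul]
    exact_mod_cast h
  exact (pow_left_inj₀ (norm_nonneg _) (norm_nonneg _) two_ne_zero).mp this

theorem norm_conjTranspose_mul_of_unitary {Q : Matrix m m ℂ} (hQ : Qᴴ * Q = 1)
    (M : Matrix m n ℂ) : ‖Qᴴ * M‖ = ‖M‖ :=
  norm_mul_of_unitary (by rw [Matrix.conjTranspose_conjTranspose]; exact mul_eq_one_comm.mp hQ) M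

theorem norm_mul_unitary {Q : Matrix m m ℂ} (hQ : Qᴴ * Q = 1) (M : Matrix n m ℂ) :
    ‖M * Q‖ = ‖M‖ := by
  rw [← Matrix.frobenius_norm_conjTranspose, Matrix.conjTranspose_mul,
    norm_conjTranspose_mul_of_unitary hQ, Matrix.frobenius_norm_conjTranspose]

theorem norm_unitary_similarity {Q : Matrix m m ℂ} (hQ : Qᴴ * Q = 1) (M : Matrix m m ℂ) :
    ‖Qᴴ * M * Q‖ = ‖M‖ := by
  rw [norm_mul_unitary hQ, norm_conjTranspose_mul_of_unitary hQ]

end Frobenius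

/-! ### Givens rotations as matrices, and the error of applying a computed one -/

section Rotation

variable {n : ℕ} {ι : Type*}

/-- The rotation `[[c, -conj s], [s, conj c]]` acting on the plane of the indices `i, j`. -/
def givensMatrix (i j : Fin n) (c s : ℂ) : Matrix (Fin n) (Fin n) ℂ := fun k l =>
  if l = i then (if k = i then c else if k = j then s else 0)
  else if l = j then (if k = i then -conj s else if k = j then conj c else 0)
  else if k = l then 1 else 0

theorem mul_givensMatrix_apply {i j : Fin n} (hij : i ≠ j) (c s : ℂ) (M : Matrix ι (Fin n) ℂ)
    (k : ι) (l : Fin n) : (M * givensMatrix i j c s) k l =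
      if l = i then M k i * c + M k j * s
      else if l = j then M k j * conj c - M k i * conj s else M k l := by
  rw [Matrix.mul_apply]
  simp only [givensMatrix]
  split_ifs with h1 h2
  · rw [Finset.sum_eq_add i j hij (fun x _ hx => by simp [hx.1, hx.2]) (by simp) (by simp)]
    simp [hij.symm]
  · rw [Finset.sum_eq_add i j hij (fun x _ hx => by simp [hx.1, hx.2]) (by simp) (by simp)]
    simp [hij.symm]
    ring
  · simp

theorem conjTranspose_givensMatrix_mul_apply {i j : Fin n} (hij : i ≠ j) (c s : ℂ)
    (M : Matrix (Fin n) ι ℂ) (k : Fin n) (l : ι) : ((givensMatrix i j c s)ᴴ * M) k l =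
      if k = i then conj c * M i l + conj s * M j l
      else if k = j then c * M j l - s * M i l else M k l := by
  have h : (givensMatrix i j c s)ᴴ * M = (Mᴴ * givensMatrix i j c s)ᴴ := by
    rw [Matrix.conjTranspose_mul, Matrix.conjTranspose_conjTranspose]
  rw [h, Matrix.conjTranspose_apply, mul_givensMatrix_apply hij]
  simp only [Matrix.conjTranspose_apply]
  split_ifs <;> simp [mul_comm]

theorem givensMatrix_unitary {i j : Fin n} (hij : i ≠ j) {c s : ℂ}
    (h : conj c * c + conj s * s = 1) : (givensMatrix i j c s)ᴴ * givensMatrix i j c s = 1 := by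
  ext k l
  rw [conjTranspose_givensMatrix_mul_apply hij, Matrix.one_apply]
  simp only [givensMatrix]
  by_cases hki : k = i
  · subst hki
    by_cases hl : l = k
    · subst hl; simp [hij.symm, h]
    · by_cases hlj : l = j
      · subst hlj; simp [hij, hij.symm]; ring
      · simp [hl, hlj, Ne.symm hl, Ne.symm hlj]
  · by_cases hkj : k = j
    · subst hkj
      by_cases hl : l = i
      · subst hl; simp [hki]; ring
      · by_cases hlj : l = k
        · subst hlj; simp [hki]; linear_combination h
        · simp [hl, hlj, Ne.symm hl, Ne.symm hlj, hki]
    · by_cases hl : l = i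
      · subst hl; simp [hki, hkj]
      · by_cases hlj : l = j
        · subst hlj; simp [hki, hkj]
        · simp [hki, hkj, hl, hlj]

/-- The stored rotation is close to the one with the parameters `c, s`, which is unitary. -/
structure Givens.Near (ε : ℝ) (G : Givens) (c s : ℂ) : Prop where
  unitary : conj c * c + conj s * s = 1
  norm_c : ‖c‖ ≤ 1
  norm_s : ‖s‖ ≤ 1
  sub_c : ‖G.c - c‖ ≤ 10 * ε
  sub_s : ‖G.s - s‖ ≤ 10 * ε

variable {ε : ℝ} {fl : ℝ → ℝ} {G : Givens} {c s : ℂ} {i j : Fin n} {e m : ℝ}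

theorem norm_conj_sub_conj (z w : ℂ) : ‖conj z - conj w‖ = ‖z - w‖ := by
  rw [← map_sub, Complex.norm_conj]

theorem norm_rotVec_sub_le (h : StandardModel ε fl) (hε : ε ≤ 1 / 100) (hG : G.Near ε c s)
    (hij : i ≠ j) {w : Fin n → ℂ} {M : Matrix (Fin n) ι ℂ} {l : ι} (he : 0 ≤ e)
    (hw : ∀ k, ‖w k - M k l‖ ≤ e) (hm : ∀ k, ‖M k l‖ ≤ m) (k : Fin n) :
    ‖rotVec fl i j G w k - ((givensMatrix i j c s)ᴴ * M) k l‖ ≤ 3 * e + 100 * ε * m := by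
  have h0 := h.nonneg
  have hm0 : 0 ≤ m := (norm_nonneg _).trans (hm k)
  rw [conjTranspose_givensMatrix_mul_apply hij, rotVec]
  split_ifs
  · exact norm_fadd_fmul_sub_le h hε (by rw [norm_conj_sub_conj]; exact hG.sub_c)
      (by rw [norm_conj_sub_conj]; exact hG.sub_s) (by rw [Complex.norm_conj]; exact hG.norm_c)
      (by rw [Complex.norm_conj]; exact hG.norm_s) (hw i) (hw j) (hm i) (hm j)
  · exact norm_fsub_fmul_sub_le h hε hG.sub_c hG.sub_s hG.norm_c hG.norm_s (hw j) (hw i) (hm j)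
      (hm i)
  · have : 0 ≤ 100 * ε * m := by positivity
    linarith [hw k]

theorem fmul_comm (fl : ℝ → ℝ) (z w : ℂ) : fmul fl z w = fmul fl w z := by
  simp only [fmul, mul_comm z.re, mul_comm z.im, add_comm]

theorem norm_rotCols_sub_le (h : StandardModel ε fl) (hε : ε ≤ 1 / 100) (hG : G.Near ε c s)
    (hij : i ≠ j) {N M : Matrix (Fin n) (Fin n) ℂ} (he : 0 ≤ e)
    (hN : ∀ k l, ‖N k l - M k l‖ ≤ e) (hm : ∀ k l, ‖M k l‖ ≤ m) (k l : Fin n) :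
    ‖rotCols fl i j G N k l - (M * givensMatrix i j c s) k l‖ ≤ 3 * e + 100 * ε * m := by
  have h0 := h.nonneg
  have hm0 : 0 ≤ m := (norm_nonneg _).trans (hm k l)
  rw [mul_givensMatrix_apply hij, rotCols]
  simp only [fmul_comm fl (N k _), mul_comm (M k _)]
  split_ifs
  · exact norm_fadd_fmul_sub_le h hε hG.sub_c hG.sub_s hG.norm_c hG.norm_s (hN k i) (hN k j)
      (hm k i) (hm k j)
  · exact norm_fsub_fmul_sub_le h hε (by rw [norm_conj_sub_conj]; exact hG.sub_c)
      (by rw [norm_conj_sub_conj]; exact hG.sub_s) (by rw [Complex.norm_conj]; exact hG.norm_c)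
      (by rw [Complex.norm_conj]; exact hG.norm_s) (hN k j) (hN k i) (hm k j) (hm k i)
  · have : 0 ≤ 100 * ε * m := by positivity
    linarith [hN k l]

/-- Rows and columns each turn an entry error `e` into `3 e + 100 ε m`, and composing the two gives
`9 e + 400 ε m`. The bound `m` is not enlarged in between because the exact row update preserves the
Frobenius norm. -/
theorem norm_rotSim_sub_le (h : StandardModel ε fl) (hε : ε ≤ 1 / 100) (hG : G.Near ε c s)
    (hij : i ≠ j) {N M : Matrix (Fin n) (Fin n) ℂ} (he : 0 ≤ e)
    (hN : ∀ k l, ‖N k l - M k l‖ ≤ e) (hm : ‖M‖ ≤ m) (k l : Fin n) :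
    ‖rotSim fl i j G N k l - ((givensMatrix i j c s)ᴴ * M * givensMatrix i j c s) k l‖
      ≤ 9 * e + 400 * ε * m := by
  have h0 := h.nonneg
  have hm0 : 0 ≤ m := (norm_nonneg _).trans hm
  have hU := givensMatrix_unitary hij hG.unitary
  have h1 := norm_rotCols_sub_le (N := rotRows fl i j G N) (M := (givensMatrix i j c s)ᴴ * M)
    (e := 3 * e + 100 * ε * m) (m := m) h hε hG hij (by positivity)
    (fun k l => norm_rotVec_sub_le h hε hG hij he (fun k => hN k l)
      (fun k => (norm_entry_le M k l).trans hm) k)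
    (fun k l => (norm_entry_le _ k l).trans
      ((norm_conjTranspose_mul_of_unitary hU M).le.trans hm)) k l
  refine h1.trans (le_of_eq ?_)
  ring

end Rotation

/-! ### One floating point operation is nearly a unitary similarity -/

section StepError

variable {n : ℕ} {ε τ : ℝ} {fl : ℝ → ℝ}

/-- A vector as a matrix with one column. -/
abbrev column (w : Fin n → ℂ) : Matrix (Fin n) (Fin 1) ℂ := Matrix.replicateCol (Fin 1) w

theorem norm_apply_le_column (w : Fin n → ℂ) (i : Fin n) : ‖w i‖ ≤ ‖column w‖ :=
  norm_entry_le (column w) i 0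

/-- The size of the data of a state. -/
noncomputable def State.size (S : State n) : ℝ := ‖S.matrix‖ + ‖column S.u‖ * ‖column S.v‖

theorem State.size_nonneg (S : State n) : 0 ≤ S.size := by unfold State.size; positivity

theorem State.norm_matrix_le_size (S : State n) : ‖S.matrix‖ ≤ S.size := by
  unfold State.size
  exact le_add_of_nonneg_right (by positivity)

/-- `S'` is obtained from `S` by the similarity with `G`, up to errors of relative size `δ`. -/
structure State.NearSimilar (δ : ℝ) (S S' : State n) (G : Matrix (Fin n) (Fin n) ℂ) : Prop where
  unitary : Gᴴ * G = 1
  u : ∀ i l, ‖(column S'.u - Gᴴ * column S.u) i l‖ ≤ δ * ‖column S.u‖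
  v : ∀ i l, ‖(column S'.v - Gᴴ * column S.v) i l‖ ≤ δ * ‖column S.v‖
  L : ∀ i j, j ≤ i → ‖S'.L i j - (Gᴴ * S.matrix * G) i j‖ ≤ δ * S.size

theorem State.matrix_of_le (S : State n) {i j : Fin n} (h : j ≤ i) : S.matrix i j = S.L i j := by
  simp [State.matrix, h]

/-- Only the entries above the diagonal are rounded. The products in their recovery formula are the
reason why `State.size` contains `‖u‖ ‖v‖` besides the norm of the matrix: cancellation between them
is not controlled by the latter. -/
theorem norm_entries_sub_matrix_le (h : StandardModel ε fl) (hε : ε ≤ 1 / 100) (S : State n)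
    (i j : Fin n) : ‖S.entries fl i j - S.matrix i j‖ ≤ 40 * ε * S.size := by
  have h0 := h.nonneg
  have hs := S.size_nonneg
  unfold State.entries State.matrix
  split_ifs with hij
  · simp; positivity
  have hL : ‖conj (S.L j i)‖ ≤ S.size := by
    rw [Complex.norm_conj, ← S.matrix_of_le (le_of_not_ge hij)]
    exact (norm_entry_le _ _ _).trans S.norm_matrix_le_size
  have hp : ∀ k l, ‖S.u k‖ * ‖S.v l‖ ≤ S.size := fun k l => by
    have : ‖S.u k‖ * ‖S.v l‖ ≤ ‖column S.u‖ * ‖column S.v‖ := by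
      gcongr <;> exact norm_apply_le_column _ _
    exact this.trans (le_add_of_nonneg_left (norm_nonneg _))
  have h1 := norm_fmul_sub_le h (by linarith) (conj (S.u j)) (S.v i)
  have h2 := norm_fmul_sub_le h (by linarith) (S.u i) (conj (S.v j))
  simp only [Complex.norm_conj] at h1 h2
  have h3 := mul_le_mul_of_nonneg_left (hp j i) h0
  have h4 := mul_le_mul_of_nonneg_left (hp i j) h0
  set p := fmul fl (conj (S.u j)) (S.v i)
  set q := fmul fl (S.u i) (conj (S.v j))
  have h5 : ‖conj (S.u j) * S.v i‖ ≤ S.size := by rw [norm_mul, Complex.norm_conj]; exact hp j i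
  have h6 : ‖S.u i * conj (S.v j)‖ ≤ S.size := by rw [norm_mul, Complex.norm_conj]; exact hp i j
  have h7 := norm_fsub_sub_le h (conj (S.L j i)) p
  have h8 := norm_fadd_sub_le h (fsub fl (conj (S.L j i)) p) q
  set s := fsub fl (conj (S.L j i)) p
  have hεs := mul_le_mul_of_nonneg_right hε hs
  have hp1 := norm_le_of_norm_sub_le h1
  have hq1 := norm_le_of_norm_sub_le h2
  have n1 := norm_sub_le (conj (S.L j i)) p
  have n2 : ‖conj (S.L j i) - p‖ ≤ (212 / 100) * S.size := by linarith
  have n3 := mul_le_mul_of_nonneg_left n2 h0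
  have hs1 := norm_le_of_norm_sub_le h7
  have n4 := norm_add_le s q
  have n5 : ‖s + q‖ ≤ 4 * S.size := by linarith
  have n6 := mul_le_mul_of_nonneg_left n5 h0
  have e1 : fadd fl s q - (conj (S.L j i) - conj (S.u j) * S.v i + S.u i * conj (S.v j))
      = (fadd fl s q - (s + q)) + ((s - (conj (S.L j i) - p)) + ((q - S.u i * conj (S.v j))
        - (p - conj (S.u j) * S.v i))) := by ring
  rw [e1]
  have t1 := norm_add_le (fadd fl s q - (s + q)) ((s - (conj (S.L j i) - p))
    + ((q - S.u i * conj (S.v j)) - (p - conj (S.u j) * S.v i)))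
  have t2 := norm_add_le (s - (conj (S.L j i) - p))
    ((q - S.u i * conj (S.v j)) - (p - conj (S.u j) * S.v i))
  have t3 := norm_sub_le (q - S.u i * conj (S.v j)) (p - conj (S.u j) * S.v i)
  have : 0 ≤ ε * S.size := by positivity
  linarith

theorem Givens.exists_near (h : StandardModel ε fl) (hε : ε ≤ 1 / 100) (a b : ℂ) :
    ∃ c s : ℂ, (givens fl a b).Near ε c s ∧
      ‖((givens fl a b).r : ℂ) - (conj c * a + conj s * b)‖ ≤ 14 * ε * (‖a‖ + ‖b‖) ∧
      c * b - s * a = 0 := by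
  obtain ⟨c, s, h1, h2, h3, h4, h5, h6, h7⟩ := exists_givens_near h hε a b
  exact ⟨c, s, ⟨h1, h2, h3, h4, h5⟩, h6, h7⟩

/-- The exact similarity is applied to the current stored data, so `u` and `v` start without error
and each acquires an error relative to its own norm. Keeping these two apart is essential later, as
`u` stays of size one while `v` has the size of `p`. -/
theorem nearSimilar_rotate (h : StandardModel ε fl) (hε : ε ≤ 1 / 100) (S : State n)
    {i j : Fin n} (hij : i ≠ j) {G : Givens} {c s : ℂ} (hG : G.Near ε c s) :
    S.NearSimilar (8000 * ε) (S.rotate fl i j G) (givensMatrix i j c s) := by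
  have h0 := h.nonneg
  have hv : ∀ (w : Fin n → ℂ) (k : Fin n) (l : Fin 1),
      ‖(column (rotVec fl i j G w) - (givensMatrix i j c s)ᴴ * column w) k l‖
        ≤ 8000 * ε * ‖column w‖ := fun w k l => by
    have := norm_rotVec_sub_le (w := w) (M := column w) (l := l) (m := ‖column w‖) (e := 0)
      h hε hG hij le_rfl (by simp) (fun k => norm_apply_le_column w k) k
    refine this.trans ?_
    have : 0 ≤ ε * ‖column w‖ := by positivity
    linarith
  refine ⟨givensMatrix_unitary hij hG.unitary, hv S.u, hv S.v, fun k l hkl => ?_⟩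
  have hs := S.size_nonneg
  have := norm_rotSim_sub_le (e := 40 * ε * S.size) h hε hG hij (by positivity)
    (norm_entries_sub_matrix_le h hε S) S.norm_matrix_le_size k l
  simp only [State.rotate, lowerPart, hkl, if_true]
  have : 0 ≤ ε * S.size := by positivity
  linarith

/-- The entry error, in units of `ε * S.size`, starts at 40 from the recovery of the upper triangle,
becomes `9 * 40 + 400 = 760` after one rotation and `9 * 760 + 400 = 7240` after the second; this is
the source of the constant 8000. -/
theorem nearSimilar_rotate₂ (h : StandardModel ε fl) (hε : ε ≤ 1 / 100) (S : State n)
    {i j k : Fin n} (hij : i ≠ j) (hjk : j ≠ k) {G₁ G₂ : Givens} {c₁ s₁ c₂ s₂ : ℂ}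
    (hG₁ : G₁.Near ε c₁ s₁) (hG₂ : G₂.Near ε c₂ s₂) :
    S.NearSimilar (8000 * ε) (S.rotate₂ fl i j k G₁ G₂)
      (givensMatrix j k c₂ s₂ * givensMatrix i j c₁ s₁) := by
  have h0 := h.nonneg
  have hU₁ := givensMatrix_unitary hij hG₁.unitary
  have hU₂ := givensMatrix_unitary hjk hG₂.unitary
  have hv : ∀ (w : Fin n → ℂ) (q : Fin n) (l : Fin 1),
      ‖(column (rotVec fl i j G₁ (rotVec fl j k G₂ w))
        - (givensMatrix j k c₂ s₂ * givensMatrix i j c₁ s₁)ᴴ * column w) q l‖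
        ≤ 8000 * ε * ‖column w‖ := fun w q l => by
    have hw : 0 ≤ ε * ‖column w‖ := by positivity
    have h1 := norm_rotVec_sub_le (w := w) (M := column w) (l := l) (m := ‖column w‖) (e := 0)
      h hε hG₂ hjk le_rfl (by simp) (fun k => norm_apply_le_column w k)
    have h2 := norm_rotVec_sub_le h hε hG₁ hij (m := ‖column w‖) (by linarith) h1
      (fun q => (norm_entry_le _ q l).trans (norm_conjTranspose_mul_of_unitary hU₂ _).le) q
    rw [Matrix.conjTranspose_mul, Matrix.mul_assoc]
    refine h2.trans ?_
    linarith
  refine ⟨?_, hv S.u, hv S.v, fun p l hpl => ?_⟩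
  · rw [Matrix.conjTranspose_mul, Matrix.mul_assoc, ← Matrix.mul_assoc _ (givensMatrix j k c₂ s₂),
      hU₂, Matrix.one_mul, hU₁]
  have hs := S.size_nonneg
  have h1 := norm_rotSim_sub_le (e := 40 * ε * S.size) h hε hG₂ hjk (by positivity)
    (norm_entries_sub_matrix_le h hε S) S.norm_matrix_le_size
  have h2 := norm_rotSim_sub_le h hε hG₁ hij (by positivity) h1
    ((norm_unitary_similarity hU₂ _).le.trans S.norm_matrix_le_size) p l
  simp only [State.rotate₂, lowerPart, hpl, if_true]
  have : 0 ≤ ε * S.size := by positivity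
  simp only [Matrix.conjTranspose_mul, Matrix.mul_assoc] at h2 ⊢
  linarith

/-- Rotations are covered by the preceding bounds. What remains are the entries that are overwritten
instead of computed: the values `r` and `0` agree with the exact similarity up to `O(ε)`, and a
deflated entry is small by assumption, which contributes the `|τ|`. -/
theorem Step.exists_nearSimilar (h : StandardModel ε fl) (hε : ε ≤ 1 / 100) {S S' : State n}
    (hS : Step τ ε fl S S') :
    ∃ G, S.NearSimilar ((8000 + |τ|) * ε) S' G := by
  have h0 := h.nonneg
  have weaken : ∀ {S' G}, S.NearSimilar (8000 * ε) S' G →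
      S.NearSimilar ((8000 + |τ|) * ε) S' G := by
    intro S' G hG
    have hle : 8000 * ε ≤ (8000 + |τ|) * ε := by
      gcongr
      exact le_add_of_nonneg_right (abs_nonneg τ)
    refine ⟨hG.unitary, fun i l => (hG.u i l).trans ?_, fun i l => (hG.v i l).trans ?_,
      fun i j hij => (hG.L i j hij).trans ?_⟩
    · gcongr
    · gcongr
    · exact mul_le_mul_of_nonneg_right hle S.size_nonneg
  have hs := S.size_nonneg
  have hes : 0 ≤ ε * S.size := by positivity
  cases hS with
  | startSingle i j σ hj =>
    -- The vector that defines the rotation is irrelevant here; only closeness to a unitary rotation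
    -- matters. Hence arbitrary shifts are allowed, and rounding errors made in forming the vector
    -- cost nothing.
    obtain ⟨c, s, hG, -⟩ := Givens.exists_near h hε (fsub fl (S.L i i) σ) (S.L j i)
    have hij : i ≠ j := fun h => by subst h; omega
    exact ⟨_, weaken (nearSimilar_rotate h hε S hij hG)⟩
  | startDouble i j k σ hj hk =>
    have hij : i ≠ j := fun h => by subst h; omega
    have hjk : j ≠ k := fun h => by subst h; omega
    simp only [State.startDouble]
    obtain ⟨c₂, s₂, hG₂, -⟩ := Givens.exists_near h hε
      (fmul fl (S.L j i) (fsub fl (fadd fl (S.L i i) (S.L j j)) (fl (2 * σ.re) : ℂ)))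
      (fmul fl (S.L j i) (S.L k j))
    obtain ⟨c₁, s₁, hG₁, -⟩ := Givens.exists_near h hε
      (fadd fl
        (fsub fl
          (fadd fl (fmul fl (S.L i i) (S.L i i)) (fmul fl (S.entries fl i j) (S.L j i)))
          (fmul fl (fl (2 * σ.re) : ℂ) (S.L i i)))
        (fnormSq fl σ : ℂ))
      ((givens fl (fmul fl (S.L j i) (fsub fl (fadd fl (S.L i i) (S.L j j)) (fl (2 * σ.re) : ℂ)))
        (fmul fl (S.L j i) (S.L k j))).r : ℂ)
    exact ⟨_, weaken (nearSimilar_rotate₂ h hε S hij hjk hG₁ hG₂)⟩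
  | chaseSingle i j l hj hl =>
    have hij : i ≠ j := fun h => by subst h; omega
    have hlj : l < j := lt_trans hl (by rw [Fin.lt_def]; omega)
    obtain ⟨c, s, hG, hr, hz⟩ := Givens.exists_near h hε (S.L i l) (S.L j l)
    have hN := nearSimilar_rotate h hε S hij hG
    have hLn : ∀ q, l ≤ q → ‖S.L q l‖ ≤ S.size := fun q hq => by
      rw [← S.matrix_of_le hq]
      exact (norm_entry_le _ _ _).trans S.norm_matrix_le_size
    -- Column `l` lies to the left of `i` and `j`, so multiplication on the right by the rotation
    -- leaves it alone.
    have hA : ∀ q, ((givensMatrix i j c s)ᴴ * S.matrix * givensMatrix i j c s) q l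
        = ((givensMatrix i j c s)ᴴ * S.matrix) q l := fun q => by
      rw [mul_givensMatrix_apply hij, if_neg hl.ne, if_neg hlj.ne]
    refine ⟨_, weaken ⟨hN.unitary, hN.u, hN.v, fun p q hpq => ?_⟩⟩
    simp only [State.chaseSingle, setEntry]
    split_ifs with h1 h2
    · obtain ⟨rfl, rfl⟩ := h1
      rw [hA, conjTranspose_givensMatrix_mul_apply hij, if_neg hij.symm, if_pos rfl,
        S.matrix_of_le hlj.le, S.matrix_of_le hl.le, hz]
      simp; positivity
    · obtain ⟨rfl, rfl⟩ := h2
      rw [hA, conjTranspose_givensMatrix_mul_apply hij, if_pos rfl,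
        S.matrix_of_le hlj.le, S.matrix_of_le hl.le]
      refine hr.trans ?_
      have := mul_le_mul_of_nonneg_left (add_le_add (hLn p hl.le) (hLn j hlj.le)) h0
      linarith
    · exact hN.L p q hpq
  | chaseDouble i j k l hj hk hl =>
    have hij : i ≠ j := fun h => by subst h; omega
    have hjk : j ≠ k := fun h => by subst h; omega
    have hik : i ≠ k := fun h => by subst h; omega
    have hlj : l < j := lt_trans hl (by rw [Fin.lt_def]; omega)
    have hlk : l < k := lt_trans hl (by rw [Fin.lt_def]; omega)
    obtain ⟨c₂, s₂, hG₂, hr₂, hz₂⟩ := Givens.exists_near h hε (S.L j l) (S.L k l)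
    obtain ⟨c₁, s₁, hG₁, hr₁, hz₁⟩ := Givens.exists_near h hε (S.L i l)
      ((givens fl (S.L j l) (S.L k l)).r : ℂ)
    have hN := nearSimilar_rotate₂ h hε S hij hjk hG₁ hG₂
    have hU₂ := givensMatrix_unitary hjk hG₂.unitary
    set r₂ : ℂ := ((givens fl (S.L j l) (S.L k l)).r : ℂ)
    have hLn : ∀ q, l ≤ q → ‖S.L q l‖ ≤ S.size := fun q hq => by
      rw [← S.matrix_of_le hq]
      exact (norm_entry_le _ _ _).trans S.norm_matrix_le_size
    have hA₂ : ∀ q, ((givensMatrix j k c₂ s₂)ᴴ * S.matrix) q l =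
        if q = j then conj c₂ * S.L j l + conj s₂ * S.L k l
        else if q = k then 0 else S.matrix q l := fun q => by
      rw [conjTranspose_givensMatrix_mul_apply hjk, S.matrix_of_le hlj.le, S.matrix_of_le hlk.le,
        hz₂]
    have hA : ∀ q, ((givensMatrix j k c₂ s₂ * givensMatrix i j c₁ s₁)ᴴ * S.matrix
          * (givensMatrix j k c₂ s₂ * givensMatrix i j c₁ s₁)) q l
        = ((givensMatrix i j c₁ s₁)ᴴ * ((givensMatrix j k c₂ s₂)ᴴ * S.matrix)) q l := fun q => by
      rw [← Matrix.mul_assoc _ (givensMatrix j k c₂ s₂), mul_givensMatrix_apply hij, if_neg hl.ne,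
        if_neg hlj.ne, mul_givensMatrix_apply hjk, if_neg hlj.ne, if_neg hlk.ne,
        Matrix.conjTranspose_mul, Matrix.mul_assoc]
    have hρ : ‖conj c₂ * S.L j l + conj s₂ * S.L k l‖ ≤ S.size := by
      have h1 := norm_entry_le ((givensMatrix j k c₂ s₂)ᴴ * S.matrix) j l
      rw [hA₂, if_pos rfl, norm_conjTranspose_mul_of_unitary hU₂] at h1
      exact h1.trans S.norm_matrix_le_size
    set ρ := conj c₂ * S.L j l + conj s₂ * S.L k l
    -- The second rotation is built from the computed radius `r₂`, whereas the exact first rotation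
    -- produces `ρ`; annihilation therefore holds only up to this difference.
    have hr₂' : ‖r₂ - ρ‖ ≤ 28 * ε * S.size := by
      have := mul_le_mul_of_nonneg_left (add_le_add (hLn j hlj.le) (hLn k hlk.le)) h0
      linarith
    have hr₂n : ‖r₂‖ ≤ 2 * S.size := by
      have := norm_le_of_norm_sub_le hr₂'
      have := mul_le_mul_of_nonneg_right hε hs
      linarith
    refine ⟨_, weaken ⟨hN.unitary, hN.u, hN.v, fun p q hpq => ?_⟩⟩
    simp only [State.chaseDouble, setEntry]
    split_ifs with h1 h2 h3
    · obtain ⟨rfl, rfl⟩ := h1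
      rw [hA, conjTranspose_givensMatrix_mul_apply hij, if_neg hik.symm, if_neg hjk.symm, hA₂,
        if_neg hjk.symm, if_pos rfl]
      simp; positivity
    · obtain ⟨rfl, rfl⟩ := h2
      rw [hA, conjTranspose_givensMatrix_mul_apply hij, if_neg hij.symm, if_pos rfl, hA₂,
        if_pos rfl, hA₂, if_neg hij, if_neg hik, S.matrix_of_le hl.le]
      have e : 0 - (c₁ * ρ - s₁ * S.L i q) = c₁ * (r₂ - ρ) := by linear_combination -hz₁
      rw [e, norm_mul]
      have : ‖c₁‖ * ‖r₂ - ρ‖ ≤ 1 * (28 * ε * S.size) := by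
        gcongr
        exact hG₁.norm_c
      linarith
    · obtain ⟨rfl, rfl⟩ := h3
      rw [hA, conjTranspose_givensMatrix_mul_apply hij, if_pos rfl, hA₂, if_neg hij, if_neg hik,
        hA₂, if_pos rfl, S.matrix_of_le hl.le]
      have e : (((givens fl (S.L p q) r₂).r : ℝ) : ℂ) - (conj c₁ * S.L p q + conj s₁ * ρ)
        = ((((givens fl (S.L p q) r₂).r : ℝ) : ℂ) - (conj c₁ * S.L p q + conj s₁ * r₂))
          + conj s₁ * (r₂ - ρ) := by ring
      rw [e]
      refine (norm_add_le _ _).trans ?_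
      rw [norm_mul, Complex.norm_conj]
      have t1 : ‖s₁‖ * ‖r₂ - ρ‖ ≤ 1 * (28 * ε * S.size) := by
        gcongr
        exact hG₁.norm_s
      have t2 := mul_le_mul_of_nonneg_left (add_le_add (hLn p hl.le) hr₂n) h0
      linarith
    · exact hN.L p q hpq
  | deflate i j hij hd =>
    have hτ : 0 ≤ (8000 + |τ|) * ε := by positivity
    -- Deflation is a perturbation of one entry, compared with the trivial similarity.
    refine ⟨1, by simp, fun k l => ?_, fun k l => ?_, fun p q hpq => ?_⟩
    · simp [State.deflate]; positivity
    · simp [State.deflate]; positivity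
    · rw [Matrix.conjTranspose_one, Matrix.one_mul, Matrix.mul_one, S.matrix_of_le hpq]
      simp only [State.deflate, setEntry]
      split_ifs with h1
      · obtain ⟨rfl, rfl⟩ := h1
        rw [zero_sub, norm_neg]
        unfold State.Negligible at hd
        rw [← frobenius_norm_sq, Real.sqrt_sq (norm_nonneg _)] at hd
        refine hd.trans ?_
        have : τ ≤ 8000 + |τ| := by linarith [le_abs_self τ]
        calc τ * ε * ‖S.matrix‖ ≤ (8000 + |τ|) * ε * ‖S.matrix‖ := by gcongr
          _ ≤ _ := by
            gcongr
            exact S.norm_matrix_le_size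
      · simp; positivity

end StepError

/-! ### Accumulation of the errors over many operations -/

section Accumulation

variable {n : ℕ} {ε τ δ : ℝ} {fl : ℝ → ℝ}

/-- The represented matrix without its rank-one part. It is Hermitian up to its diagonal. -/
def State.herm (S : State n) : Matrix (Fin n) (Fin n) ℂ :=
  S.matrix - column S.u * (column S.v)ᴴ

theorem column_mul_conjTranspose_apply (u v : Fin n → ℂ) (i j : Fin n) :
    (column u * (column v)ᴴ) i j = u i * conj (v j) := by
  simp [Matrix.mul_apply]

/-- Exact for every state, by the definition of the entries above the diagonal: rounding can spoil
the symmetry only on the diagonal, which is stored as complex numbers. -/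
theorem State.herm_apply_of_ne (S : State n) {i j : Fin n} (hij : i ≠ j) :
    S.herm i j = conj (S.herm j i) := by
  have key : ∀ i j : Fin n, i < j → S.herm i j = conj (S.herm j i) := fun i j h => by
    simp only [State.herm, Matrix.sub_apply, column_mul_conjTranspose_apply, State.matrix, h.le,
      not_le.mpr h, if_true, if_false, map_sub, map_mul, Complex.conj_conj]
    ring
  rcases lt_or_gt_of_ne hij with h | h
  · exact key i j h
  · rw [key j i h, Complex.conj_conj]

/-- `S` is the similarity by the unitary `Q` of the data `F, u₀, v₀`, up to the given errors. -/
structure State.Tracks (F : Matrix (Fin n) (Fin n) ℂ) (u₀ v₀ : Fin n → ℂ) (α β κ γ : ℝ)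
    (S : State n) (Q : Matrix (Fin n) (Fin n) ℂ) : Prop where
  unitary : Qᴴ * Q = 1
  u : ‖column S.u - Qᴴ * column u₀‖ ≤ α
  v : ‖column S.v - Qᴴ * column v₀‖ ≤ β
  skew : ‖S.herm - S.hermᴴ‖ ≤ κ
  herm : ‖S.herm - Qᴴ * F * Q‖ ≤ γ

theorem norm_column_le_of_sub {Q : Matrix (Fin n) (Fin n) ℂ} (hQ : Qᴴ * Q = 1) {u u' : Fin n → ℂ}
    {α : ℝ} (h : ‖column u' - Qᴴ * column u‖ ≤ α) : ‖column u'‖ ≤ ‖column u‖ + α := by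
  have := norm_le_norm_add_norm_sub' (column u') (Qᴴ * column u)
  rw [norm_conjTranspose_mul_of_unitary hQ] at this
  linarith

theorem State.NearSimilar.norm_u_sub_le {S S' : State n} {G : Matrix (Fin n) (Fin n) ℂ}
    (h : S.NearSimilar δ S' G) (hδ : 0 ≤ δ) :
    ‖column S'.u - Gᴴ * column S.u‖ ≤ n * (δ * ‖column S.u‖) :=
  norm_le_of_entries_column (by positivity) h.u

theorem State.NearSimilar.norm_v_sub_le {S S' : State n} {G : Matrix (Fin n) (Fin n) ℂ}
    (h : S.NearSimilar δ S' G) (hδ : 0 ≤ δ) :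
    ‖column S'.v - Gᴴ * column S.v‖ ≤ n * (δ * ‖column S.v‖) :=
  norm_le_of_entries_column (by positivity) h.v

/-- The stored lower triangle contributes one multiple of `n * δ * S.size`. Subtracting the rank-one
part contributes three more: two from the change of `u`, multiplied by the new `v` of norm at most
`2 ‖v‖`, and one from the change of `v`. -/
theorem State.NearSimilar.norm_herm_apply_sub_le {S S' : State n} {G : Matrix (Fin n) (Fin n) ℂ}
    (h : S.NearSimilar δ S' G) (hδ : 0 ≤ δ) (hn : 1 ≤ n) (hδn : n * δ ≤ 1) {i j : Fin n}
    (hij : j ≤ i) : ‖S'.herm i j - (Gᴴ * S.herm * G) i j‖ ≤ 4 * n * δ * S.size := by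
  have hu := h.norm_u_sub_le hδ
  have hv := h.norm_v_sub_le hδ
  have hv' := norm_column_le_of_sub h.unitary hv
  have hL := h.L i j hij
  have e1 : Gᴴ * S.herm * G
      = Gᴴ * S.matrix * G - (Gᴴ * column S.u) * (Gᴴ * column S.v)ᴴ := by
    simp only [State.herm, Matrix.mul_sub, Matrix.sub_mul, Matrix.conjTranspose_mul,
      Matrix.conjTranspose_conjTranspose, Matrix.mul_assoc]
  have e2 : (Gᴴ * column S.u) * (Gᴴ * column S.v)ᴴ - column S'.u * (column S'.v)ᴴ
      = -((column S'.u - Gᴴ * column S.u) * (column S'.v)ᴴ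
        + (Gᴴ * column S.u) * (column S'.v - Gᴴ * column S.v)ᴴ) := by
    simp only [Matrix.conjTranspose_sub, Matrix.sub_mul, Matrix.mul_sub]
    abel
  have e3 : S'.herm i j - (Gᴴ * S.herm * G) i j = (S'.L i j - (Gᴴ * S.matrix * G) i j)
      + ((Gᴴ * column S.u) * (Gᴴ * column S.v)ᴴ - column S'.u * (column S'.v)ᴴ) i j := by
    rw [e1, State.herm, Matrix.sub_apply, Matrix.sub_apply, Matrix.sub_apply, S'.matrix_of_le hij]
    ring
  have hR : ‖(Gᴴ * column S.u) * (Gᴴ * column S.v)ᴴ - column S'.u * (column S'.v)ᴴ‖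
      ≤ 3 * (n * δ * (‖column S.u‖ * ‖column S.v‖)) := by
    rw [e2, norm_neg]
    refine (norm_add_le _ _).trans ?_
    have t1 := Matrix.frobenius_norm_mul (column S'.u - Gᴴ * column S.u) (column S'.v)ᴴ
    have t2 := Matrix.frobenius_norm_mul (Gᴴ * column S.u) (column S'.v - Gᴴ * column S.v)ᴴ
    rw [Matrix.frobenius_norm_conjTranspose] at t1 t2
    rw [norm_conjTranspose_mul_of_unitary h.unitary] at t2
    have t3 : ‖column S'.v‖ ≤ 2 * ‖column S.v‖ := by
      have := mul_le_mul_of_nonneg_right hδn (norm_nonneg (column S.v))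
      linarith
    have t4 : ‖column S'.u - Gᴴ * column S.u‖ * ‖column S'.v‖
        ≤ (n * (δ * ‖column S.u‖)) * (2 * ‖column S.v‖) := by gcongr
    have t5 : ‖column S.u‖ * ‖column S'.v - Gᴴ * column S.v‖
        ≤ ‖column S.u‖ * (n * (δ * ‖column S.v‖)) := by gcongr
    linarith
  rw [e3]
  refine (norm_add_le _ _).trans ?_
  have h1 := (norm_entry_le _ i j).trans hR
  have h2 : ‖column S.u‖ * ‖column S.v‖ ≤ S.size := le_add_of_nonneg_left (norm_nonneg _)
  have h3 : n * δ * (‖column S.u‖ * ‖column S.v‖) ≤ n * δ * S.size := by gcongr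
  have h4 : 1 * (δ * S.size) ≤ n * (δ * S.size) := by
    have := S.size_nonneg
    gcongr
    exact_mod_cast hn
  linarith

/-- The heart of the stability argument. The exact similarity carries the skew part of `H` to a
matrix `K` of the same norm. Reflecting the new lower triangle into the upper one discards `K` off
the diagonal: the new skew part is the diagonal of `K` plus fresh errors, while the upper triangle
moves by the upper part of `K`. Taking a part of a matrix does not increase its Frobenius norm, so
`κ` and `γ` change by addition only and no factor larger than one is ever applied to old errors. -/
theorem State.Tracks.of_nearSimilar {F Q : Matrix (Fin n) (Fin n) ℂ} {u₀ v₀ : Fin n → ℂ}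
    {α β κ γ e : ℝ} {S S' : State n} {G : Matrix (Fin n) (Fin n) ℂ}
    (hS : S.Tracks F u₀ v₀ α β κ γ Q) (hδ : 0 ≤ δ) (h : S.NearSimilar δ S' G) (he : 0 ≤ e)
    (hH : ∀ i j, j ≤ i → ‖S'.herm i j - (Gᴴ * S.herm * G) i j‖ ≤ e) :
    S'.Tracks F u₀ v₀ (α + n * (δ * ‖column S.u‖)) (β + n * (δ * ‖column S.v‖)) (κ + n * (2 * e))
      (γ + κ + n * e) (Q * G) := by
  have hK := (norm_unitary_similarity h.unitary (S.herm - S.hermᴴ)).le.trans hS.skew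
  set K := Gᴴ * (S.herm - S.hermᴴ) * G with hKdef
  have hKapp : ∀ i j, K i j = (Gᴴ * S.herm * G) i j - conj ((Gᴴ * S.herm * G) j i) := fun i j => by
    have : K = Gᴴ * S.herm * G - (Gᴴ * S.herm * G)ᴴ := by
      simp only [hKdef, Matrix.mul_sub, Matrix.sub_mul, Matrix.conjTranspose_mul,
        Matrix.conjTranspose_conjTranspose, Matrix.mul_assoc]
    rw [this, Matrix.sub_apply, Matrix.conjTranspose_apply]; rfl
  have hvec : ∀ {w' w w₀ : Fin n → ℂ} {α d : ℝ}, ‖column w - Qᴴ * column w₀‖ ≤ α →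
      ‖column w' - Gᴴ * column w‖ ≤ d → ‖column w' - (Q * G)ᴴ * column w₀‖ ≤ α + d := by
    intro w' w w₀ α d h1 h2
    have e1 : column w' - (Q * G)ᴴ * column w₀
        = (column w' - Gᴴ * column w) + Gᴴ * (column w - Qᴴ * column w₀) := by
      rw [Matrix.conjTranspose_mul, Matrix.mul_sub, Matrix.mul_assoc]; abel
    rw [e1]
    refine (norm_add_le _ _).trans ?_
    rw [norm_conjTranspose_mul_of_unitary h.unitary]
    linarith
  refine ⟨?_, hvec hS.u (h.norm_u_sub_le hδ), hvec hS.v (h.norm_v_sub_le hδ), ?_, ?_⟩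
  · rw [Matrix.conjTranspose_mul, Matrix.mul_assoc, ← Matrix.mul_assoc _ Q, hS.unitary,
      Matrix.one_mul, h.unitary]
  -- The new skew part is diagonal: `E₁` is what is inherited from `K`, `E₂` comes from the errors
  -- of this operation.
  · set E₁ : Matrix (Fin n) (Fin n) ℂ := fun i j => if i = j then K i j else 0
    set E₂ : Matrix (Fin n) (Fin n) ℂ := fun i j => if i = j then
      (S'.herm i j - (Gᴴ * S.herm * G) i j) - conj (S'.herm i j - (Gᴴ * S.herm * G) i j) else 0
    have e1 : S'.herm - S'.hermᴴ = E₁ + E₂ := by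
      ext i j
      rw [Matrix.sub_apply, Matrix.add_apply, Matrix.conjTranspose_apply]
      simp only [E₁, E₂]
      split_ifs with hij
      · subst hij
        rw [hKapp, map_sub, RCLike.star_def]; ring
      · rw [S'.herm_apply_of_ne hij, RCLike.star_def]; ring
    rw [e1]
    refine (norm_add_le _ _).trans (add_le_add ?_ ?_)
    · refine (frobenius_norm_mono fun i j => ?_).trans hK
      simp only [E₁]
      split_ifs <;> simp
    · refine norm_le_of_entries_square (by positivity) fun i j => ?_
      simp only [E₂]
      split_ifs with hij
      · refine (norm_sub_le _ _).trans ?_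
        rw [Complex.norm_conj]
        have := hH i j hij.ge
        linarith
      · simp; positivity
  -- `E₁` is the effect of reflecting a matrix that is not exactly Hermitian, and costs `κ`; `E₂`
  -- collects the new errors below the diagonal and their mirror images.
  · set E₁ : Matrix (Fin n) (Fin n) ℂ := fun i j => if j ≤ i then 0 else -K i j
    set E₂ : Matrix (Fin n) (Fin n) ℂ := fun i j => if j ≤ i then
      S'.herm i j - (Gᴴ * S.herm * G) i j else conj (S'.herm j i - (Gᴴ * S.herm * G) j i)
    have e1 : S'.herm - (Q * G)ᴴ * F * (Q * G)
        = Gᴴ * (S.herm - Qᴴ * F * Q) * G + E₁ + E₂ := by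
      have e2 : S'.herm - Gᴴ * S.herm * G = E₁ + E₂ := by
        ext i j
        rw [Matrix.sub_apply, Matrix.add_apply]
        simp only [E₁, E₂]
        split_ifs with hij
        · ring
        · rw [hKapp, map_sub, ← S'.herm_apply_of_ne (ne_of_lt (not_le.mp hij))]; ring
      rw [add_assoc, ← e2]
      simp only [Matrix.conjTranspose_mul, Matrix.mul_sub, Matrix.sub_mul, Matrix.mul_assoc]
      abel
    rw [e1]
    refine (norm_add_le _ _).trans (add_le_add ((norm_add_le _ _).trans (add_le_add ?_ ?_)) ?_)
    · rw [norm_unitary_similarity h.unitary]; exact hS.herm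
    · refine (frobenius_norm_mono fun i j => ?_).trans hK
      simp only [E₁]
      split_ifs <;> simp
    · refine norm_le_of_entries_square (by positivity) fun i j => ?_
      simp only [E₂]
      split_ifs with hij
      · exact hH i j hij
      · rw [Complex.norm_conj]; exact hH j i (le_of_not_ge hij)

theorem State.Tracks.size_le {F Q : Matrix (Fin n) (Fin n) ℂ} {u₀ v₀ : Fin n → ℂ}
    {α β κ γ P : ℝ} {S : State n} (hS : S.Tracks F u₀ v₀ α β κ γ Q) (hn : 1 ≤ n) (hP : 1 ≤ P)
    (hF : ‖F‖ ≤ n) (hu : ‖column u₀‖ ≤ 1) (hv : ‖column v₀‖ ≤ P) (hα : α ≤ 1) (hβ : β ≤ P)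
    (hγ : γ ≤ 1) : ‖column S.u‖ ≤ 2 ∧ ‖column S.v‖ ≤ 2 * P ∧ S.size ≤ 10 * n * P := by
  have h1 := norm_column_le_of_sub hS.unitary hS.u
  have h2 := norm_column_le_of_sub hS.unitary hS.v
  have h3 := norm_le_norm_add_norm_sub' S.herm (Qᴴ * F * Q)
  rw [norm_unitary_similarity hS.unitary] at h3
  have h4 := hS.herm
  have hn' : (1 : ℝ) ≤ n := by exact_mod_cast hn
  have hu' : ‖column S.u‖ ≤ 2 := by linarith
  have hv' : ‖column S.v‖ ≤ 2 * P := by linarith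
  refine ⟨hu', hv', ?_⟩
  have e : S.matrix = S.herm + column S.u * (column S.v)ᴴ := by simp [State.herm]
  have h5 : ‖column S.u‖ * ‖column S.v‖ ≤ 2 * (2 * P) := by gcongr
  have h6 : ‖S.matrix‖ ≤ ‖S.herm‖ + ‖column S.u‖ * ‖column S.v‖ := by
    rw [e]
    refine (norm_add_le _ _).trans ?_
    have := Matrix.frobenius_norm_mul (column S.u) (column S.v)ᴴ
    rw [Matrix.frobenius_norm_conjTranspose] at this
    linarith
  unfold State.size
  nlinarith [mul_nonneg (sub_nonneg.mpr hn') (sub_nonneg.mpr hP)]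

/-- The error of the Hermitian part in one operation. -/
noncomputable def stepError (n : ℕ) (P δ : ℝ) : ℝ := 80 * n ^ 3 * P * δ

/-- `S` tracks the initial data with the errors of `N` operations. -/
def State.TracksAfter (F : Matrix (Fin n) (Fin n) ℂ) (u₀ v₀ : Fin n → ℂ) (P δ : ℝ) (N : ℕ)
    (S : State n) : Prop :=
  ∃ Q, S.Tracks F u₀ v₀ (2 * N * n * δ) (2 * N * n * P * δ) (N * stepError n P δ)
    (N ^ 2 * stepError n P δ) Q

/-- A bootstrap: the smallness assumption keeps the accumulated errors below the size of the
original data, so `State.size` stays below `10 * n * P`, and this in turn bounds the next error by a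
fixed `stepError`. -/
theorem State.TracksAfter.succ {F : Matrix (Fin n) (Fin n) ℂ} {u₀ v₀ : Fin n → ℂ} {P : ℝ} {N : ℕ}
    {S S' : State n} {G : Matrix (Fin n) (Fin n) ℂ} (hS : S.TracksAfter F u₀ v₀ P δ N)
    (hn : 1 ≤ n) (hP : 1 ≤ P) (hF : ‖F‖ ≤ n) (hu : ‖column u₀‖ ≤ 1) (hv : ‖column v₀‖ ≤ P)
    (hδ : 0 ≤ δ) (hN : ((N : ℝ) + 1) ^ 2 * stepError n P δ ≤ 1) (h : S.NearSimilar δ S' G) :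
    S'.TracksAfter F u₀ v₀ P δ (N + 1) := by
  obtain ⟨Q, hQ⟩ := hS
  have hn' : (1 : ℝ) ≤ n := by exact_mod_cast hn
  have hN0 : (0 : ℝ) ≤ N := Nat.cast_nonneg N
  have hE0 : 0 ≤ stepError n P δ := by unfold stepError; positivity
  have hnδ : 2 * n * P * δ ≤ stepError n P δ := by
    unfold stepError
    have : (n : ℝ) ≤ n ^ 3 := le_self_pow₀ hn' (by norm_num)
    have : n * (P * δ) ≤ n ^ 3 * (P * δ) := by gcongr
    have : 0 ≤ n * (P * δ) := by positivity
    linarith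
  have hnδ' : 2 * n * δ ≤ 2 * n * P * δ := by
    have : n * δ * 1 ≤ n * δ * P := by gcongr
    linarith
  have hNE : (N : ℝ) * stepError n P δ ≤ 1 := le_trans (by gcongr; nlinarith) hN
  have hα : 2 * N * n * δ ≤ 1 := by
    have := mul_le_mul_of_nonneg_left (hnδ'.trans hnδ) hN0
    linarith
  have hβ : 2 * N * n * P * δ ≤ P := by
    have := mul_le_mul_of_nonneg_left hnδ hN0
    linarith
  have hγ : (N : ℝ) ^ 2 * stepError n P δ ≤ 1 := le_trans (by gcongr; linarith) hN
  have hE1 : stepError n P δ ≤ 1 :=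
    le_trans (le_mul_of_one_le_left hE0 (by nlinarith)) hN
  obtain ⟨h1, h2, h3⟩ := hQ.size_le hn hP hF hu hv hα hβ hγ
  -- The factor 40 is `4 * 10`, from the entry bound of one operation and the bound on the size of
  -- the state.
  have hH : ∀ i j, j ≤ i → ‖S'.herm i j - (Gᴴ * S.herm * G) i j‖ ≤ 40 * n ^ 2 * P * δ := by
    intro i j hij
    refine (h.norm_herm_apply_sub_le hδ hn (by nlinarith) hij).trans ?_
    have : 4 * n * δ * S.size ≤ 4 * n * δ * (10 * n * P) := by gcongr
    linarith
  have hT := hQ.of_nearSimilar hδ h (by positivity) hH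
  have hne : n * (2 * (40 * n ^ 2 * P * δ)) = stepError n P δ := by unfold stepError; ring
  refine ⟨Q * G, hT.unitary, hT.u.trans ?_, hT.v.trans ?_, hT.skew.trans ?_, hT.herm.trans ?_⟩
  · have : n * (δ * ‖column S.u‖) ≤ n * (δ * 2) := by gcongr
    push_cast; linarith
  · have : n * (δ * ‖column S.v‖) ≤ n * (δ * (2 * P)) := by gcongr
    push_cast; linarith
  · rw [hne]; push_cast; linarith
  -- In units of `stepError`, the new error is at most `N ^ 2 + N + 1 / 2 ≤ (N + 1) ^ 2`: summing a
  -- linearly growing skew part gives quadratic growth.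
  · have : (0 : ℝ) ≤ N * stepError n P δ := by positivity
    push_cast; linarith

/-- The count starts at 1 because the rounding of the initial data is treated as an operation of its
own. -/
theorem Run.tracksAfter (h : StandardModel ε fl) (hε : ε ≤ 1 / 100)
    {F : Matrix (Fin n) (Fin n) ℂ} {u₀ v₀ : Fin n → ℂ} {P : ℝ} {N : ℕ} {S₀ S : State n}
    (hn : 1 ≤ n) (hP : 1 ≤ P) (hF : ‖F‖ ≤ n) (hu : ‖column u₀‖ ≤ 1) (hv : ‖column v₀‖ ≤ P)
    (hR : Run τ ε fl N S₀ S) (hS₀ : S₀.TracksAfter F u₀ v₀ P ((8000 + |τ|) * ε) 1)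
    (hN : ((N : ℝ) + 1) ^ 2 * stepError n P ((8000 + |τ|) * ε) ≤ 1) :
    S.TracksAfter F u₀ v₀ P ((8000 + |τ|) * ε) (N + 1) := by
  have h0 := h.nonneg
  have hδ : 0 ≤ (8000 + |τ|) * ε := by positivity
  have hE0 : 0 ≤ stepError n P ((8000 + |τ|) * ε) := by unfold stepError; positivity
  induction hR with
  | refl => exact hS₀
  | tail hR hs ih =>
    obtain ⟨G, hG⟩ := hs.exists_nearSimilar h hε
    have ih' := ih hS₀ (le_trans (by gcongr; linarith) hN)
    exact ih'.succ hn hP hF hu hv hδ (by exact_mod_cast hN) hG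

end Accumulation

/-! ### Size of the colleague data, and the rounding of the initial state -/

section Initial

variable {n : ℕ}

theorem norm_colleagueF_apply_le (i j : Fin n) : ‖colleagueF n i j‖ ≤ 1 := by
  unfold colleagueF
  split_ifs
  · rw [Complex.norm_real, Real.norm_of_nonneg (by positivity)]
    have : Real.sqrt 2 ≤ 2 := Real.sqrt_le_left (by norm_num) |>.mpr (by norm_num)
    linarith
  · norm_num
  · simp

theorem norm_colleagueF_le : ‖colleagueF n‖ ≤ n := by
  simpa using norm_le_of_entries_square zero_le_one (norm_colleagueF_apply_le (n := n))

theorem colleagueF_conjTranspose : (colleagueF n)ᴴ = colleagueF n := by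
  ext i j
  rw [Matrix.conjTranspose_apply]
  simp only [colleagueF, or_comm]
  split_ifs <;> simp

theorem norm_column_colleagueU_le : ‖column (colleagueU n)‖ ≤ 1 := by
  refine abs_le_of_sq_le_sq' ?_ zero_le_one |>.2
  rw [frobenius_norm_sq]
  rcases n with _ | n
  · simp
  · simp [Fin.sum_univ_succ, colleagueU]

theorem norm_colleagueV_apply_le (p : EuclideanSpace ℂ (Fin (n + 1))) (hp : p (Fin.last n) = 1)
    (j : Fin n) : ‖colleagueV p j‖ ≤ ‖p (Fin.castSucc (Fin.rev j))‖ := by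
  have e : (⟨n - 1 - (j : ℕ), by omega⟩ : Fin (n + 1)) = Fin.castSucc (Fin.rev j) := by
    ext; simp; omega
  have h2 : Real.sqrt 2 ≤ 2 := Real.sqrt_le_left (by norm_num) |>.mpr (by norm_num)
  unfold colleagueV
  rw [hp, Complex.norm_conj, norm_neg, e, norm_div, norm_mul, mul_one]
  have h3 : ‖(if (j : ℕ) + 1 = n then ((Real.sqrt 2 : ℝ) : ℂ) else 1)‖ ≤ 2 := by
    split_ifs
    · rw [Complex.norm_real, Real.norm_of_nonneg (by positivity)]; exact h2
    · norm_num
  rw [div_le_iff₀ (by norm_num)]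
  have := mul_le_mul_of_nonneg_right h3 (norm_nonneg (p (Fin.castSucc (Fin.rev j))))
  simp only [RCLike.norm_ofNat]
  linarith

theorem norm_column_colleagueV_le (p : EuclideanSpace ℂ (Fin (n + 1))) (hp : p (Fin.last n) = 1) :
    ‖column (colleagueV p)‖ ≤ ‖p‖ := by
  refine abs_le_of_sq_le_sq' ?_ (norm_nonneg _) |>.2
  rw [frobenius_norm_sq, EuclideanSpace.norm_sq_eq, Fin.sum_univ_castSucc]
  calc ∑ i, ∑ j, ‖column (colleagueV p) i j‖ ^ 2
      = ∑ i, ‖colleagueV p i‖ ^ 2 := by simp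
    _ ≤ ∑ i, ‖p (Fin.castSucc (Fin.rev i))‖ ^ 2 := by
        gcongr
        exact norm_colleagueV_apply_le p hp _
    _ = ∑ i, ‖p (Fin.castSucc i)‖ ^ 2 :=
        Equiv.sum_comp Fin.revPerm fun i => ‖p (Fin.castSucc i)‖ ^ 2
    _ ≤ _ := le_add_of_nonneg_right (by positivity)

/-- The state which stores the exact data of the colleague matrix. -/
noncomputable def exactState (p : EuclideanSpace ℂ (Fin (n + 1))) : State n :=
  ⟨colleague p, colleagueU n, colleagueV p⟩

theorem exactState_matrix (p : EuclideanSpace ℂ (Fin (n + 1))) :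
    (exactState p).matrix = colleague p := by
  ext i j
  unfold State.matrix
  split_ifs
  · rfl
  · have h : conj (colleagueF n j i) = colleagueF n i j :=
      congrFun (congrFun colleagueF_conjTranspose i) j
    simp only [exactState, colleague, map_add, map_mul, Complex.conj_conj, h]
    ring

theorem exactState_herm (p : EuclideanSpace ℂ (Fin (n + 1))) :
    (exactState p).herm = colleagueF n := by
  ext i j
  rw [State.herm, exactState_matrix, Matrix.sub_apply, column_mul_conjTranspose_apply]
  simp [exactState, colleague]

theorem State.Represents.tracksAfter {ε τ P : ℝ} (hε : 0 ≤ ε)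
    {p : EuclideanSpace ℂ (Fin (n + 1))} {S₀ : State n} (hS : S₀.Represents τ ε p)
    (hn : 1 ≤ n) (hP : 1 ≤ P) (hv : ‖column (colleagueV p)‖ ≤ P)
    (hN : stepError n P ((8000 + |τ|) * ε) ≤ 1) :
    S₀.TracksAfter (colleagueF n) (colleagueU n) (colleagueV p) P ((8000 + |τ|) * ε) 1 := by
  have hδ : 0 ≤ (8000 + |τ|) * ε := by positivity
  have hτ : τ * ε ≤ (8000 + |τ|) * ε := by
    gcongr
    linarith [le_abs_self τ]
  have h0 : (exactState p).TracksAfter (colleagueF n) (colleagueU n) (colleagueV p) P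
      ((8000 + |τ|) * ε) 0 := by
    refine ⟨1, by simp, ?_, ?_, ?_, ?_⟩
    · simp [exactState]
    · simp [exactState]
    · simp [exactState_herm, colleagueF_conjTranspose]
    · simp [exactState_herm]
  -- Forming the initial data with relative error `τ ε` is one perturbed operation, with the trivial
  -- similarity, starting from the exact data.
  refine h0.succ (G := 1) hn hP norm_colleagueF_le norm_column_colleagueU_le hv hδ
    (by simpa using hN) ⟨by simp, fun i l => ?_, fun i l => ?_, fun i j hij => ?_⟩
  · have : column S₀.u = column (exactState p).u := by
      ext i l; exact hS.2.1 i
    rw [this]; simp; positivity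
  · have := (hS.2.2 i).trans (mul_le_mul hτ (norm_apply_le_column _ i) (norm_nonneg _) hδ)
    simpa [exactState] using this
  · have h1 := hS.1 i j hij
    have h2 : ‖colleague p i j‖ ≤ (exactState p).size := by
      rw [← exactState_matrix]
      exact (norm_entry_le _ _ _).trans (exactState p).norm_matrix_le_size
    have h3 := h1.trans (mul_le_mul hτ h2 (norm_nonneg _) hδ)
    simpa [exactState_matrix] using h3

end Initial

/-! ### Lower bounds for `x - F`, and determinants near the identity -/

section Resolvent

variable {n : ℕ}

theorem norm_trace_conjTranspose_mul_le {q : ℕ} (A B : Matrix (Fin n) (Fin q) ℂ) :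
    ‖(Aᴴ * B).trace‖ ≤ ‖A‖ * ‖B‖ := by
  have e : (Aᴴ * B).trace = ∑ x : Fin q × Fin n, conj (A x.2 x.1) * B x.2 x.1 := by
    rw [Fintype.sum_prod_type]
    simp [Matrix.trace, Matrix.mul_apply]
  have e2 : ∀ M : Matrix (Fin n) (Fin q) ℂ,
      ‖M‖ ^ 2 = ∑ x : Fin q × Fin n, ‖M x.2 x.1‖ ^ 2 := fun M => by
    rw [Fintype.sum_prod_type, frobenius_norm_sq, Finset.sum_comm]
  refine abs_le_of_sq_le_sq' ?_ (by positivity) |>.2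
  rw [mul_pow, e2, e2, e]
  refine le_trans ?_ (Finset.sum_mul_sq_le_sq_mul_sq _ _ _)
  gcongr
  refine (norm_sum_le _ _).trans (le_of_eq ?_)
  simp

/-- The Schur test for the quadratic form of a symmetric nonnegative matrix. -/
theorem sum_mul_mul_le_of_schur {f : Matrix (Fin n) (Fin n) ℝ} {w : Fin n → ℝ}
    (hf : ∀ i j, 0 ≤ f i j) (hsymm : ∀ i j, f i j = f j i) (hw : ∀ i, 0 < w i)
    (h : ∀ i, ∑ j, f i j * w j ≤ w i) (a : Fin n → ℝ) :
    ∑ i, ∑ j, f i j * (a i * a j) ≤ ∑ i, a i ^ 2 := by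
  have h1 : ∑ i, ∑ j, f i j * (a i ^ 2 * (w j / w i)) ≤ ∑ i, a i ^ 2 := by
    gcongr with i
    calc ∑ j, f i j * (a i ^ 2 * (w j / w i)) = a i ^ 2 / w i * ∑ j, f i j * w j := by
          rw [Finset.mul_sum]
          exact Finset.sum_congr rfl fun j _ => by ring
      _ ≤ a i ^ 2 / w i * w i := by
          have := hw i
          gcongr
          exact h i
      _ = a i ^ 2 := div_mul_cancel₀ _ (hw i).ne'
  have h2 : ∑ i, ∑ j, f i j * (a j ^ 2 * (w i / w j))
      = ∑ i, ∑ j, f i j * (a i ^ 2 * (w j / w i)) := by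
    rw [Finset.sum_comm]
    exact Finset.sum_congr rfl fun i _ => Finset.sum_congr rfl fun j _ => by rw [hsymm]
  have h3 : ∑ i, ∑ j, f i j * (a i * a j)
      ≤ ∑ i, ∑ j, (f i j * (a i ^ 2 * (w j / w i)) + f i j * (a j ^ 2 * (w i / w j))) / 2 := by
    gcongr with i _ j _
    have hi := hw i
    have hj := hw j
    -- The weighted arithmetic-geometric mean inequality; its two terms have equal sums by the
    -- symmetry of `f`.
    have : a i * a j ≤ (a i ^ 2 * (w j / w i) + a j ^ 2 * (w i / w j)) / 2 := by
      have e : (a i ^ 2 * (w j / w i) + a j ^ 2 * (w i / w j)) / 2 - a i * a j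
          = (a i * w j - a j * w i) ^ 2 / (2 * w i * w j) := by
        field_simp
        ring
      have : 0 ≤ (a i * w j - a j * w i) ^ 2 / (2 * w i * w j) := by positivity
      linarith
    have := mul_le_mul_of_nonneg_left this (hf i j)
    linarith
  refine h3.trans ?_
  simp only [← Finset.sum_div, Finset.sum_add_distrib]
  rw [h2]
  linarith

/-- For one column this says that the numerical range of `F` lies in `[-1, 1]`: the form is real
because `F` is Hermitian, and the Schur test bounds it. The trace handles all columns of `Y` at
once, as an average of Rayleigh quotients. -/
theorem exists_trace_eq_of_schur {F : Matrix (Fin n) (Fin n) ℂ} (hF : Fᴴ = F) {w : Fin n → ℝ}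
    (hw : ∀ i, 0 < w i) (h : ∀ i, ∑ j, ‖F i j‖ * w j ≤ w i) {q : ℕ}
    (Y : Matrix (Fin n) (Fin q) ℂ) :
    ∃ t ∈ Set.Icc (-1 : ℝ) 1, (Yᴴ * (F * Y)).trace = ((t * ‖Y‖ ^ 2 : ℝ) : ℂ) := by
  have hreal : conj ((Yᴴ * (F * Y)).trace) = (Yᴴ * (F * Y)).trace := by
    have := Matrix.trace_conjTranspose (Yᴴ * (F * Y))
    rw [Matrix.conjTranspose_mul, Matrix.conjTranspose_mul, Matrix.conjTranspose_conjTranspose, hF,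
      Matrix.mul_assoc] at this
    exact this.symm
  obtain ⟨r, hr⟩ := Complex.conj_eq_iff_real.mp hreal
  have hbound : ‖(Yᴴ * (F * Y)).trace‖ ≤ ‖Y‖ ^ 2 := by
    have e : (Yᴴ * (F * Y)).trace = ∑ l, ∑ i, ∑ j, conj (Y i l) * (F i j * Y j l) := by
      simp [Matrix.trace, Matrix.mul_apply, Finset.mul_sum]
    rw [e, frobenius_norm_sq, Finset.sum_comm (s := Finset.univ (α := Fin n))]
    refine (norm_sum_le _ _).trans ?_
    gcongr with l
    refine (norm_sum_le _ _).trans (le_trans ?_ (sum_mul_mul_le_of_schur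
      (f := fun i j => ‖F i j‖) (fun _ _ => norm_nonneg _) (fun i j => ?_) hw h
      (fun i => ‖Y i l‖)))
    · gcongr with i
      refine (norm_sum_le _ _).trans (le_of_eq (Finset.sum_congr rfl fun j _ => ?_))
      rw [norm_mul, norm_mul, Complex.norm_conj]
      ring
    · have : F i j = conj (F j i) := (congrFun (congrFun hF i) j).symm
      rw [this, Complex.norm_conj]
  rw [hr, Complex.norm_real, Real.norm_eq_abs] at hbound
  rcases eq_or_ne (‖Y‖ ^ 2) 0 with h0 | h0
  · refine ⟨0, by norm_num, ?_⟩
    rw [h0] at hbound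
    rw [hr, abs_nonpos_iff.mp hbound]
    simp
  · refine ⟨r / ‖Y‖ ^ 2, ?_, by rw [hr, div_mul_cancel₀ _ h0]⟩
    rw [Set.mem_Icc, ← abs_le, abs_div, abs_of_nonneg (sq_nonneg ‖Y‖)]
    exact div_le_one_of_le₀ hbound (sq_nonneg _)

/-- `X` is bounded below by `d`. -/
def BoundedBelow (d : ℝ) (X : Matrix (Fin n) (Fin n) ℂ) : Prop :=
  ∀ (q : ℕ) (Y : Matrix (Fin n) (Fin q) ℂ), d * ‖Y‖ ≤ ‖X * Y‖

/-- By Cauchy-Schwarz, `‖Y‖ ‖(x - F) Y‖` is at least `|tr (Y^* (x - F) Y)| = |x - t| ‖Y‖²`. Allowing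
any number of columns in `BoundedBelow` gives the resolvent bound without a loss in `n`, both on the
matrix `E` and on single columns. -/
theorem boundedBelow_scalar_sub {F : Matrix (Fin n) (Fin n) ℂ} (hF : Fᴴ = F) {w : Fin n → ℝ}
    (hw : ∀ i, 0 < w i) (h : ∀ i, ∑ j, ‖F i j‖ * w j ≤ w i) {x : ℂ} {d : ℝ}
    (hx : ∀ t ∈ Set.Icc (-1 : ℝ) 1, d ≤ ‖x - t‖) : BoundedBelow d (Matrix.scalar (Fin n) x - F) := by
  intro q Y
  obtain ⟨t, ht, e⟩ := exists_trace_eq_of_schur hF hw h Y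
  have h1 := norm_trace_conjTranspose_mul_le Y ((Matrix.scalar (Fin n) x - F) * Y)
  have e1 : (Yᴴ * ((Matrix.scalar (Fin n) x - F) * Y)).trace = (x - t) * ((‖Y‖ ^ 2 : ℝ) : ℂ) := by
    have e2 : Yᴴ * ((Matrix.scalar (Fin n) x - F) * Y) = x • (Yᴴ * Y) - Yᴴ * (F * Y) := by
      rw [Matrix.sub_mul, Matrix.mul_sub, Matrix.scalar_apply, ← Matrix.smul_one_eq_diagonal,
        Matrix.smul_mul, Matrix.one_mul, Matrix.mul_smul]
    rw [e2, Matrix.trace_sub, Matrix.trace_smul, ← frobenius_norm_sq_eq_trace, e, smul_eq_mul]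
    push_cast
    ring
  rw [e1, norm_mul, Complex.norm_real, Real.norm_of_nonneg (sq_nonneg _)] at h1
  have h2 := mul_le_mul_of_nonneg_right (hx t ht) (sq_nonneg ‖Y‖)
  rcases (norm_nonneg Y).eq_or_lt with h0 | h0
  · rw [← h0]; simp
  · nlinarith

theorem BoundedBelow.sub {d γ : ℝ} {X E : Matrix (Fin n) (Fin n) ℂ} (h : BoundedBelow d X)
    (hE : ‖E‖ ≤ γ) : BoundedBelow (d - γ) (X - E) := by
  intro q Y
  have h1 := h q Y
  have h2 := Matrix.frobenius_norm_mul E Y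
  have h3 := mul_le_mul_of_nonneg_right hE (norm_nonneg Y)
  have h4 := norm_sub_norm_le (X * Y) (E * Y)
  rw [Matrix.sub_mul]
  linarith

theorem BoundedBelow.isUnit_det {d : ℝ} {X : Matrix (Fin n) (Fin n) ℂ} (h : BoundedBelow d X)
    (hd : 0 < d) : IsUnit X.det := by
  rw [isUnit_iff_ne_zero]
  intro h0
  obtain ⟨v, hv, hXv⟩ := Matrix.exists_mulVec_eq_zero_iff.mpr h0
  have h1 := h 1 (column v)
  have h2 : X * column v = 0 := by
    ext i l
    exact congrFun hXv i
  rw [h2, norm_zero] at h1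
  have h3 : ‖column v‖ = 0 := le_antisymm (by nlinarith [norm_nonneg (column v)]) (norm_nonneg _)
  apply hv
  ext i
  have := norm_apply_le_column v i
  rw [h3] at this
  exact norm_le_zero_iff.mp this

theorem BoundedBelow.norm_inv_mul_le {d : ℝ} {X : Matrix (Fin n) (Fin n) ℂ}
    (h : BoundedBelow d X) (hd : 0 < d) {q : ℕ} (Y : Matrix (Fin n) (Fin q) ℂ) :
    ‖X⁻¹ * Y‖ ≤ ‖Y‖ / d := by
  have h1 := h q (X⁻¹ * Y)
  rw [Matrix.mul_nonsing_inv_cancel_left _ _ (h.isUnit_det hd)] at h1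
  rw [le_div_iff₀ hd]
  linarith

/-- In the Leibniz expansion, each term differs from that of the identity by at most the
corresponding difference of products of nonnegative numbers. Enlarging the sum from permutations to
all self-maps of the indices makes it factor into `(1 + n η)^n - 1`. -/
theorem norm_det_one_sub_sub_one_le {E : Matrix (Fin n) (Fin n) ℂ} {η : ℝ}
    (hE : ∀ i j, ‖E i j‖ ≤ η) : ‖(1 - E).det - 1‖ ≤ (1 + n * η) ^ n - 1 := by
  -- `g f` majorizes the change of the product along `f`; it is defined for all maps so that the
  -- enlarged sum can be evaluated.
  set g : (Fin n → Fin n) → ℝ := fun f =>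
    ∏ i, ((if f i = i then 1 else 0) + η) - ∏ i, (if f i = i then 1 else 0)
  have prod_bound : ∀ (s : Finset (Fin n)) (a b : Fin n → ℂ) (c : Fin n → ℝ),
      (∀ i, ‖a i‖ ≤ c i) → (∀ i, ‖b i‖ ≤ η) →
      ‖∏ i ∈ s, (a i - b i) - ∏ i ∈ s, a i‖ ≤ ∏ i ∈ s, (c i + η) - ∏ i ∈ s, c i := by
    intro s a b c ha hb
    induction s using Finset.induction_on with
    | empty => simp
    | insert i s hi ih =>
      rw [Finset.prod_insert hi, Finset.prod_insert hi, Finset.prod_insert hi,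
        Finset.prod_insert hi]
      have h1 : ‖∏ i ∈ s, (a i - b i)‖ ≤ ∏ i ∈ s, (c i + η) := by
        rw [norm_prod]
        refine Finset.prod_le_prod (fun _ _ => norm_nonneg _) fun k _ => ?_
        exact (norm_sub_le _ _).trans (add_le_add (ha k) (hb k))
      have e : (a i - b i) * ∏ i ∈ s, (a i - b i) - a i * ∏ i ∈ s, a i
          = a i * (∏ i ∈ s, (a i - b i) - ∏ i ∈ s, a i) - b i * ∏ i ∈ s, (a i - b i) := by ring
      rw [e]
      refine (norm_sub_le _ _).trans ?_
      rw [norm_mul, norm_mul]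
      have h2 := mul_le_mul (ha i) ih (norm_nonneg _) ((norm_nonneg _).trans (ha i))
      have h3 := mul_le_mul (hb i) h1 (norm_nonneg _) ((norm_nonneg _).trans (hb i))
      linarith
  have hterm : ∀ f : Fin n → Fin n,
      ‖∏ i, (1 - E) (f i) i - ∏ i, (1 : Matrix (Fin n) (Fin n) ℂ) (f i) i‖ ≤ g f := fun f => by
    refine prod_bound Finset.univ (fun i => (1 : Matrix (Fin n) (Fin n) ℂ) (f i) i)
      (fun i => E (f i) i) (fun i => if f i = i then 1 else 0) (fun i => ?_) (fun i => hE _ _)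
    rw [Matrix.one_apply]
    split_ifs <;> simp
  have hg : ∀ f, 0 ≤ g f := fun f => (norm_nonneg _).trans (hterm f)
  have e1 : (1 - E).det - 1 = ∑ σ : Equiv.Perm (Fin n), ((Equiv.Perm.sign σ : ℤ) : ℂ) *
      (∏ i, (1 - E) (σ i) i - ∏ i, (1 : Matrix (Fin n) (Fin n) ℂ) (σ i) i) := by
    simp only [mul_sub, Finset.sum_sub_distrib]
    rw [← Matrix.det_apply', ← Matrix.det_apply', Matrix.det_one]
  have e2 : ∑ f : Fin n → Fin n, g f = (1 + n * η) ^ n - 1 := by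
    simp only [g, Finset.sum_sub_distrib]
    rw [← Fintype.prod_sum fun i k => (if k = i then (1 : ℝ) else 0) + η,
      ← Fintype.prod_sum fun i k => (if k = i then (1 : ℝ) else 0)]
    simp [Finset.sum_add_distrib]
  rw [e1, ← e2]
  refine (norm_sum_le _ _).trans ?_
  calc ∑ σ : Equiv.Perm (Fin n), _ ≤ ∑ σ : Equiv.Perm (Fin n), g σ := by
        gcongr with σ
        rw [norm_mul]
        have : ‖((Equiv.Perm.sign σ : ℤ) : ℂ)‖ = 1 := by
          rcases Int.units_eq_one_or (Equiv.Perm.sign σ) with h | h <;> simp [h]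
        rw [this, one_mul]
        exact hterm σ
    _ = ∑ f ∈ Finset.univ.image (fun σ : Equiv.Perm (Fin n) => (σ : Fin n → Fin n)), g f :=
        (Finset.sum_image fun σ _ τ _ h => Equiv.coe_fn_injective h).symm
    _ ≤ ∑ f, g f := Finset.sum_le_sum_of_subset_of_nonneg (Finset.subset_univ _)
        fun f _ _ => hg f

theorem norm_det_one_sub_sub_one_le_of_small {E : Matrix (Fin n) (Fin n) ℂ} {η : ℝ}
    (hE : ‖E‖ ≤ η) (hη : n ^ 2 * η ≤ 1) : ‖(1 - E).det - 1‖ ≤ 2 * n ^ 2 * η := by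
  have hη0 : 0 ≤ η := (norm_nonneg _).trans hE
  refine (norm_det_one_sub_sub_one_le fun i j => (norm_entry_le E i j).trans hE).trans ?_
  have h1 : (1 + n * η) ^ n ≤ Real.exp (n ^ 2 * η) := by
    calc (1 + n * η) ^ n ≤ (Real.exp (n * η)) ^ n := by
          gcongr
          linarith [Real.add_one_le_exp (n * η)]
      _ = Real.exp (n ^ 2 * η) := by rw [← Real.exp_nat_mul]; ring_nf
  have h2 : |Real.exp (n ^ 2 * η) - 1| ≤ 2 * |(n : ℝ) ^ 2 * η| :=
    Real.abs_exp_sub_one_le (by rw [abs_of_nonneg (by positivity)]; exact hη)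
  rw [abs_of_nonneg (by positivity : 0 ≤ (n : ℝ) ^ 2 * η)] at h2
  have := le_abs_self (Real.exp (n ^ 2 * η) - 1)
  linarith

end Resolvent

/-! ### The Hermitian part `F`, the polynomial `T_n`, and a resolvent formula for `p` -/

section Colleague

variable {n : ℕ}

/-- The values at `x` of the scaled Chebyshev basis, in the order of the colleague matrix. -/
noncomputable def chebVec (n : ℕ) (x : ℂ) : Fin n → ℂ := fun i =>
  if (i : ℕ) + 1 = n then ((Real.sqrt 2 / 2 : ℝ) : ℂ)
  else (Polynomial.Chebyshev.T ℂ ((n - 1 - (i : ℕ) : ℕ) : ℤ)).eval x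

theorem sqrt_two_half_mul_self :
    ((Real.sqrt 2 / 2 : ℝ) : ℂ) * ((Real.sqrt 2 / 2 : ℝ) : ℂ) = 1 / 2 := by
  rw [← Complex.ofReal_mul]
  have : Real.sqrt 2 / 2 * (Real.sqrt 2 / 2) = 1 / 2 := by
    have := Real.mul_self_sqrt (show (0 : ℝ) ≤ 2 by norm_num)
    linarith
  rw [this]; norm_num

theorem eval_T_succ_succ (m : ℕ) (x : ℂ) :
    (Polynomial.Chebyshev.T ℂ ((m + 2 : ℕ) : ℤ)).eval x
      = 2 * x * (Polynomial.Chebyshev.T ℂ ((m + 1 : ℕ) : ℤ)).eval x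
        - (Polynomial.Chebyshev.T ℂ (m : ℤ)).eval x := by
  push_cast
  simp

theorem colleagueF_apply_of_succ {i j : Fin n} (h : (i : ℕ) + 1 = j) :
    colleagueF n i j = if (j : ℕ) + 1 = n then ((Real.sqrt 2 / 2 : ℝ) : ℂ) else 1 / 2 := by
  simp only [colleagueF, h, true_or, if_true]
  have h2 : ¬ (j : ℕ) = n := by omega
  simp [h2]

theorem colleagueF_comm (i j : Fin n) : colleagueF n i j = colleagueF n j i := by
  simp only [colleagueF, or_comm]

theorem colleagueF_apply_eq_zero {i j : Fin n} (h : (i : ℕ) + 1 ≠ j) (h' : (j : ℕ) + 1 ≠ i) :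
    colleagueF n i j = 0 := by
  simp [colleagueF, h, h']

/-- The rows are the three-term recurrence of the Chebyshev polynomials; the first row lacks the
term with `T_n`, which appears as the correction. The scaling of `T_0` by `√2 / 2` is what makes the
recurrence matrix symmetric. -/
theorem sum_colleagueF_mul_chebVec (hn : 2 ≤ n) (x : ℂ) (i : Fin n) :
    ∑ j, colleagueF n i j * chebVec n x j = x * chebVec n x i
      - if (i : ℕ) = 0 then (Polynomial.Chebyshev.T ℂ (n : ℤ)).eval x / 2 else 0 := by
  have up : ∀ j : Fin n, (i : ℕ) + 1 = j → colleagueF n i j * chebVec n x j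
      = (Polynomial.Chebyshev.T ℂ ((n - 2 - (i : ℕ) : ℕ) : ℤ)).eval x / 2 := fun j h => by
    rw [colleagueF_apply_of_succ h, chebVec]
    split_ifs with hj
    · rw [sqrt_two_half_mul_self]
      have : n - 2 - (i : ℕ) = 0 := by omega
      rw [this]; simp
    · have : n - 1 - (j : ℕ) = n - 2 - (i : ℕ) := by omega
      rw [this]; ring
  by_cases h0 : (i : ℕ) = 0
  · rw [if_pos h0, Finset.sum_eq_single (⟨1, by omega⟩ : Fin n), up _ (by simp [h0]), chebVec,
      if_neg (by omega), h0]
    · obtain ⟨m, rfl⟩ := Nat.exists_eq_add_of_le' hn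
      have := eval_T_succ_succ m x
      simp only [Nat.add_sub_cancel, Nat.sub_zero, Nat.succ_sub_one] at this ⊢
      rw [this]
      ring
    · intro j _ hj
      have : (j : ℕ) ≠ 1 := fun h => hj (Fin.ext h)
      rw [colleagueF_apply_eq_zero (by omega) (by omega), zero_mul]
    · simp
  · rw [if_neg h0, sub_zero]
    set k : Fin n := ⟨i - 1, by omega⟩ with hk
    have hki : (k : ℕ) + 1 = i := by simp only [hk]; omega
    by_cases hi : (i : ℕ) + 1 = n
    · rw [Finset.sum_eq_single k, colleagueF_comm, colleagueF_apply_of_succ hki, if_pos hi, chebVec,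
        chebVec, if_pos hi, if_neg (by omega)]
      · have : n - 1 - (k : ℕ) = 1 := by omega
        rw [this]
        simp [mul_comm]
      · intro j _ hj
        have : (j : ℕ) ≠ k := fun h => hj (Fin.ext h)
        rw [colleagueF_apply_eq_zero (by omega) (by omega), zero_mul]
      · simp
    · set l : Fin n := ⟨i + 1, by omega⟩ with hl
      rw [Finset.sum_eq_add k l, up l rfl, colleagueF_comm, colleagueF_apply_of_succ hki, if_neg hi,
        chebVec, chebVec, if_neg hi, if_neg (by omega)]
      · obtain ⟨m, hm⟩ : ∃ m, n - 2 - (i : ℕ) = m := ⟨_, rfl⟩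
        have e1 : n - 1 - (k : ℕ) = m + 2 := by omega
        have e2 : n - 1 - (i : ℕ) = m + 1 := by omega
        rw [hm, e1, e2, eval_T_succ_succ]
        ring
      · intro h
        have := congrArg Fin.val h
        simp only [hl] at this
        omega
      · intro j _ hj
        have h1 : (j : ℕ) ≠ k := fun h => hj.1 (Fin.ext h)
        have h2 : (j : ℕ) ≠ l := fun h => hj.2 (Fin.ext h)
        rw [colleagueF_apply_eq_zero (Ne.symm h2) (by omega), zero_mul]
      · simp
      · simp

/-- The weights of the Schur test for the Hermitian part of the colleague matrix. -/
noncomputable def schurWeight (n : ℕ) : Fin n → ℝ := fun i =>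
  if (i : ℕ) + 1 = n then Real.sqrt 2 / 2 else 1

theorem schurWeight_pos (i : Fin n) : 0 < schurWeight n i := by
  unfold schurWeight
  split_ifs <;> positivity

theorem chebVec_one (i : Fin n) : chebVec n 1 i = schurWeight n i := by
  unfold chebVec schurWeight
  split_ifs <;> simp

theorem colleagueF_eq_norm (i j : Fin n) : colleagueF n i j = ((‖colleagueF n i j‖ : ℝ) : ℂ) := by
  unfold colleagueF
  split_ifs
  · rw [Complex.norm_real, Real.norm_of_nonneg (by positivity)]
  · norm_num
  · simp

/-- The weights are the scaled Chebyshev basis at `x = 1`, where every `T_k` equals 1. The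
recurrence says there that `F w = w - e₁ / 2`, and `F` has nonnegative entries. -/
theorem sum_norm_colleagueF_mul_schurWeight_le (hn : 2 ≤ n) (i : Fin n) :
    ∑ j, ‖colleagueF n i j‖ * schurWeight n j ≤ schurWeight n i := by
  have h := sum_colleagueF_mul_chebVec hn 1 i
  have h' : ((∑ j, ‖colleagueF n i j‖ * schurWeight n j : ℝ) : ℂ)
      = ((schurWeight n i - if (i : ℕ) = 0 then 1 / 2 else 0 : ℝ) : ℂ) := by
    have e : ((∑ j, ‖colleagueF n i j‖ * schurWeight n j : ℝ) : ℂ)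
        = ∑ j, colleagueF n i j * chebVec n 1 j := by
      rw [Complex.ofReal_sum]
      refine Finset.sum_congr rfl fun j _ => ?_
      rw [Complex.ofReal_mul, ← colleagueF_eq_norm, chebVec_one]
    rw [e, h, chebVec_one, one_mul, Polynomial.Chebyshev.T_eval_one]
    split_ifs <;> simp
  have h2 := Complex.ofReal_injective h'
  rw [h2]
  split_ifs <;> linarith

theorem colleagueF_boundedBelow (hn : 2 ≤ n) {x : ℂ} {d : ℝ}
    (hx : ∀ t ∈ Set.Icc (-1 : ℝ) 1, d ≤ ‖x - t‖) :
    BoundedBelow d (Matrix.scalar (Fin n) x - colleagueF n) :=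
  boundedBelow_scalar_sub colleagueF_conjTranspose schurWeight_pos
    (sum_norm_colleagueF_mul_schurWeight_le hn) hx

theorem scalar_sub_colleagueF_mul_chebVec (hn : 2 ≤ n) (x : ℂ) :
    (Matrix.scalar (Fin n) x - colleagueF n) * column (chebVec n x)
      = ((Polynomial.Chebyshev.T ℂ (n : ℤ)).eval x / 2) • column (colleagueU n) := by
  ext i l
  have := sum_colleagueF_mul_chebVec hn x i
  rw [Matrix.sub_mul, Matrix.sub_apply, Matrix.scalar_apply, Matrix.diagonal_mul,
    Matrix.mul_apply]
  simp only [Matrix.replicateCol_apply, Matrix.smul_apply, colleagueU, this]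
  split_ifs <;> simp

/-- Multiplying `X t = (T_n / 2) e₁` by the adjugate of `X = x - F` and comparing last entries gives
the determinant. Only one corner entry of the adjugate is needed, and its minor is triangular with
the negated subdiagonal of `F` on its diagonal. -/
theorem two_pow_mul_det_scalar_sub_colleagueF (hn : 2 ≤ n) (x : ℂ) :
    2 ^ (n - 1) * (Matrix.scalar (Fin n) x - colleagueF n).det
      = (Polynomial.Chebyshev.T ℂ (n : ℤ)).eval x := by
  have h := scalar_sub_colleagueF_mul_chebVec hn x
  obtain ⟨m, rfl⟩ := Nat.exists_eq_add_of_le' hn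
  set X := Matrix.scalar (Fin (m + 2)) x - colleagueF (m + 2) with hX
  have h1 := congrArg (fun M => (X.adjugate * M) (Fin.last (m + 1)) 0) h
  simp only [← Matrix.mul_assoc, Matrix.adjugate_mul] at h1
  have h2 : X.adjugate (Fin.last (m + 1)) 0
      = (1 / 2) ^ m * ((Real.sqrt 2 / 2 : ℝ) : ℂ) := by
    rw [Matrix.adjugate_fin_succ_eq_det_submatrix, Fin.succAbove_zero, Fin.succAbove_last,
      Matrix.det_of_isUpperTriangular]
    · have hd : ∀ i : Fin (m + 1), (X.submatrix Fin.succ Fin.castSucc) i i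
          = -(if (i : ℕ) = m then ((Real.sqrt 2 / 2 : ℝ) : ℂ) else 1 / 2) := fun i => by
        have hne : Fin.succ i ≠ Fin.castSucc i := fun h => by
          have := congrArg Fin.val h
          simp at this
        rw [Matrix.submatrix_apply, hX, Matrix.sub_apply, Matrix.scalar_apply,
          Matrix.diagonal_apply_ne _ hne, zero_sub, colleagueF_comm,
          colleagueF_apply_of_succ (by simp)]
        simp
      simp only [hd, Fin.prod_univ_castSucc]
      simp only [Fin.val_castSucc, Fin.val_last, if_true]
      have : ∀ i : Fin m, ((i : ℕ) = m) = False := fun i => by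
        simp [i.isLt.ne]
      simp only [this, if_false, Finset.prod_const, Finset.card_univ, Fintype.card_fin]
      have e : (-1 : ℂ) ^ (m + 1) * (-(1 / 2)) ^ m * -1 = (1 / 2) ^ m := by
        rw [pow_succ, neg_pow (1 / 2 : ℂ)]
        have : (-1 : ℂ) ^ m * (-1) ^ m = 1 := by rw [← mul_pow]; norm_num
        linear_combination (1 / 2) ^ m * this
      rw [← e]
      simp
      ring
    · intro i j hij
      have h1 : (j : ℕ) < i := hij
      have hne : Fin.succ i ≠ Fin.castSucc j := fun h => by
        have := congrArg Fin.val h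
        simp at this
        omega
      rw [Matrix.submatrix_apply, hX, Matrix.sub_apply, Matrix.scalar_apply,
        Matrix.diagonal_apply_ne _ hne, zero_sub, colleagueF_apply_eq_zero, neg_zero]
      · simp; omega
      · simp; omega
  have h3 : (X.adjugate * ((Polynomial.Chebyshev.T ℂ ((m + 2 : ℕ) : ℤ)).eval x / 2) •
      column (colleagueU (m + 2))) (Fin.last (m + 1)) 0
      = (Polynomial.Chebyshev.T ℂ ((m + 2 : ℕ) : ℤ)).eval x / 2 *
        X.adjugate (Fin.last (m + 1)) 0 := by
    rw [Matrix.mul_smul, Matrix.smul_apply, Matrix.mul_apply, Fin.sum_univ_succ]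
    simp [colleagueU]
  rw [h3, h2, Matrix.smul_mul, Matrix.one_mul, Matrix.smul_apply] at h1
  simp only [Matrix.replicateCol_apply, chebVec, Fin.val_last, if_true, smul_eq_mul] at h1
  have hs : ((Real.sqrt 2 / 2 : ℝ) : ℂ) ≠ 0 := by
    rw [Complex.ofReal_ne_zero]; positivity
  have h4 : X.det = (Polynomial.Chebyshev.T ℂ ((m + 2 : ℕ) : ℤ)).eval x / 2 * (1 / 2) ^ m := by
    apply mul_right_cancel₀ hs
    rw [h1]; ring
  rw [h4, Nat.add_sub_assoc (by norm_num), Nat.add_one_sub_one, pow_succ, one_div, inv_pow]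
  field_simp

theorem eval_chebPoly (p : EuclideanSpace ℂ (Fin (n + 1))) (x : ℂ) :
    (chebPoly p).eval x
      = ∑ j : Fin (n + 1), p j * (Polynomial.Chebyshev.T ℂ ((j : ℕ) : ℤ)).eval x := by
  simp [chebPoly, Polynomial.eval_finsetSum]

theorem sum_conj_colleagueV_mul_chebVec (p : EuclideanSpace ℂ (Fin (n + 1)))
    (hp : p (Fin.last n) = 1) (x : ℂ) :
    ∑ j, conj (colleagueV p j) * chebVec n x j
      = -(1 / 2) * ((chebPoly p).eval x - (Polynomial.Chebyshev.T ℂ (n : ℤ)).eval x) := by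
  rw [eval_chebPoly, Fin.sum_univ_castSucc, hp, one_mul, Fin.val_last, add_sub_cancel_right,
    Finset.mul_sum, ← Equiv.sum_comp Fin.revPerm]
  refine Finset.sum_congr rfl fun j _ => ?_
  rw [Fin.revPerm_apply, colleagueV, Complex.conj_conj, hp, chebVec]
  have e : (⟨n - 1 - (Fin.rev j : ℕ), by omega⟩ : Fin (n + 1)) = Fin.castSucc j := by
    ext; simp [Fin.val_rev]; omega
  have e2 : n - 1 - (Fin.rev j : ℕ) = j := by simp [Fin.val_rev]; omega
  rw [e, e2, Fin.val_castSucc]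
  split_ifs with h
  · have : (j : ℕ) = 0 := by omega
    have h2 := sqrt_two_half_mul_self
    push_cast at h2 ⊢
    rw [this]
    simp only [Nat.cast_zero, Polynomial.Chebyshev.T_zero, Polynomial.eval_one]
    linear_combination -p j.castSucc * h2
  · ring

/-- The vector `t` of scaled Chebyshev values is `(T_n / 2) X⁻¹ u`, and pairing it with `v` returns
the lower part of `p` up to the factor `-1 / 2`. -/
theorem eval_chebPoly_eq (hn : 2 ≤ n) (p : EuclideanSpace ℂ (Fin (n + 1)))
    (hp : p (Fin.last n) = 1) {x : ℂ}
    (hx : IsUnit (Matrix.scalar (Fin n) x - colleagueF n).det) :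
    (chebPoly p).eval x = (Polynomial.Chebyshev.T ℂ (n : ℤ)).eval x *
      (1 - ((column (colleagueV p))ᴴ * ((Matrix.scalar (Fin n) x - colleagueF n)⁻¹ *
        column (colleagueU n))) 0 0) := by
  set X := Matrix.scalar (Fin n) x - colleagueF n
  set T := (Polynomial.Chebyshev.T ℂ (n : ℤ)).eval x
  have h1 : column (chebVec n x) = (T / 2) • (X⁻¹ * column (colleagueU n)) := by
    rw [← Matrix.mul_smul, ← scalar_sub_colleagueF_mul_chebVec hn x,
      Matrix.nonsing_inv_mul_cancel_left _ _ hx]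
  have h2 : ((column (colleagueV p))ᴴ * column (chebVec n x)) 0 0
      = -(1 / 2) * ((chebPoly p).eval x - T) := by
    rw [← sum_conj_colleagueV_mul_chebVec p hp, Matrix.mul_apply]
    rfl
  rw [h1, Matrix.mul_smul, Matrix.smul_apply, smul_eq_mul] at h2
  linear_combination 2 * h2

end Colleague

/-! ### Chebyshev polynomials on the ellipse `x = (z + z⁻¹) / 2` -/

section Ellipse

theorem eval_T_joukowski {z : ℂ} (hz : z ≠ 0) (m : ℕ) :
    (Polynomial.Chebyshev.T ℂ (m : ℤ)).eval ((z + z⁻¹) / 2)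
      = (z ^ (m : ℤ) + z ^ (-(m : ℤ))) / 2 := by
  induction m using Nat.twoStepInduction with
  | zero => simp
  | one => simp
  | more m h1 h2 =>
    rw [eval_T_succ_succ, h1, h2]
    simp only [zpow_neg, zpow_natCast]
    field_simp
    ring

/-- Writing `t = (e + e⁻¹) / 2` with `|e| = 1` factors the difference as `(z - e) (z - e⁻¹) / (2
z)`. Each factor in the numerator is at least `η` in modulus, and the denominator is at most 4. -/
theorem le_norm_joukowski_sub {z : ℂ} {η : ℝ} (hη : 0 ≤ η) (hη1 : η ≤ 1) (hz : ‖z‖ = 1 + η)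
    {t : ℝ} (ht : t ∈ Set.Icc (-1 : ℝ) 1) : η ^ 2 / 4 ≤ ‖(z + z⁻¹) / 2 - t‖ := by
  have hz0 : z ≠ 0 := norm_pos_iff.mp (by rw [hz]; linarith)
  have ht2 : 0 ≤ 1 - t ^ 2 := by nlinarith [ht.1, ht.2]
  set e : ℂ := ⟨t, Real.sqrt (1 - t ^ 2)⟩ with he
  have h1 : e * conj e = 1 := by
    rw [Complex.mul_conj, Complex.normSq_apply]
    simp only [he, Real.mul_self_sqrt ht2]
    norm_num
    ring
  have h2 : e + conj e = 2 * t := by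
    rw [Complex.add_conj]; simp [he]
  have hn : ‖e‖ = 1 := by
    have : ‖e‖ * ‖e‖ = 1 := by
      have := congrArg norm h1
      simpa using this
    nlinarith [norm_nonneg e]
  have e1 : (z + z⁻¹) / 2 - t = (z - e) * (z - conj e) / (2 * z) := by
    have : (z - e) * (z - conj e) = z * z - 2 * t * z + 1 := by
      linear_combination h1 - z * h2
    rw [this]
    field_simp
    ring
  have h3 : η ≤ ‖z - e‖ := by
    have := norm_sub_norm_le z e
    linarith
  have h4 : η ≤ ‖z - conj e‖ := by
    have := norm_sub_norm_le z (conj e)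
    rw [Complex.norm_conj] at this
    linarith
  rw [e1, norm_div, norm_mul, norm_mul, hz, RCLike.norm_ofNat, div_le_div_iff₀ (by norm_num)
    (by positivity)]
  have := mul_le_mul h3 h4 hη (norm_nonneg _)
  nlinarith

/-- The radius `1 + 1 / n` is chosen so that `|z|^n` is at most Euler's number, while the ellipse is
still at a distance of order `n⁻²` from `[-1, 1]`. -/
theorem norm_eval_T_joukowski_le {n : ℕ} (hn : 1 ≤ n) {z : ℂ} (hz : ‖z‖ = 1 + 1 / (n : ℝ)) :
    ‖(Polynomial.Chebyshev.T ℂ (n : ℤ)).eval ((z + z⁻¹) / 2)‖ ≤ 3 := by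
  have hn' : (0 : ℝ) < n := by exact_mod_cast hn
  have h1 : 1 ≤ ‖z‖ := by rw [hz]; linarith [show 0 ≤ 1 / (n : ℝ) by positivity]
  have hz0 : z ≠ 0 := norm_pos_iff.mp (by linarith)
  rw [eval_T_joukowski hz0, zpow_neg, zpow_natCast, norm_div, RCLike.norm_ofNat]
  have h2 : ‖z ^ n‖ ≤ 3 := by
    rw [norm_pow, hz]
    calc (1 + 1 / (n : ℝ)) ^ n ≤ (Real.exp (1 / n)) ^ n := by
          gcongr
          linarith [Real.add_one_le_exp (1 / (n : ℝ))]
      _ = Real.exp 1 := by rw [← Real.exp_nat_mul]; field_simp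
      _ ≤ 3 := by linarith [Real.exp_one_lt_d9]
  have h3 : ‖(z ^ n)⁻¹‖ ≤ 1 := by
    rw [norm_inv, norm_pow]
    exact inv_le_one_of_one_le₀ (one_le_pow₀ h1)
  have := norm_add_le (z ^ n) (z ^ n)⁻¹
  linarith

theorem sum_zpow_mul_primitiveRoot {N : ℕ} {ω : ℂ} (hω : IsPrimitiveRoot ω N)
    (ρ : ℂ) {e : ℤ} (he : ¬ (N : ℤ) ∣ e) :
    ∑ k ∈ Finset.range N, (ρ * ω ^ k) ^ e = 0 := by
  have h1 : ω ^ e ≠ 1 := fun h => he ((hω.zpow_eq_one_iff_dvd e).mp h)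
  have h2 : ∀ k : ℕ, (ρ * ω ^ k) ^ e = ρ ^ e * (ω ^ e) ^ k := fun k => by
    rw [mul_zpow, ← zpow_natCast, ← zpow_natCast, ← zpow_mul, ← zpow_mul, mul_comm (k : ℤ)]
  simp only [h2]
  rw [← Finset.mul_sum, geom_sum_eq h1]
  have : (ω ^ e) ^ N = 1 := by
    rw [← zpow_natCast, ← zpow_mul, mul_comm, zpow_mul, zpow_natCast, hω.pow_eq_one, one_zpow]
  rw [this]; simp

/-- The Chebyshev coefficients of a polynomial are bounded by its values on an ellipse. -/
theorem norm_apply_le_of_eval_joukowski {n : ℕ} (q : EuclideanSpace ℂ (Fin (n + 1))) {ρ B : ℝ}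
    (hρ : 1 ≤ ρ) (hB : ∀ z : ℂ, ‖z‖ = ρ → ‖(chebPoly q).eval ((z + z⁻¹) / 2)‖ ≤ B)
    (j : Fin (n + 1)) : ‖q j‖ ≤ 2 * B := by
  -- The frequencies `m - j` and `-m - j` lie between `-2 n` and `n`, so with `2 n + 1` nodes there
  -- is no aliasing.
  set N := 2 * n + 1 with hN
  obtain ⟨ω, hω⟩ : ∃ ω : ℂ, IsPrimitiveRoot ω N :=
    ⟨_, Complex.isPrimitiveRoot_exp N (by omega)⟩
  have hω1 : ‖ω‖ = 1 := hω.norm'_eq_one (by omega)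
  have hρ0 : (ρ : ℂ) ≠ 0 := by
    rw [Complex.ofReal_ne_zero]; linarith
  have hω0 : ω ≠ 0 := norm_pos_iff.mp (by rw [hω1]; norm_num)
  have hz : ∀ k : ℕ, ‖(ρ : ℂ) * ω ^ k‖ = ρ := fun k => by
    rw [norm_mul, norm_pow, hω1, one_pow, mul_one, Complex.norm_real,
      Real.norm_of_nonneg (by linarith)]
  have hz0 : ∀ k : ℕ, (ρ : ℂ) * ω ^ k ≠ 0 := fun k => mul_ne_zero hρ0 (pow_ne_zero _ hω0)
  have hsum : ∀ e : ℤ, |e| < N →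
      ∑ k ∈ Finset.range N, ((ρ : ℂ) * ω ^ k) ^ e = if e = 0 then (N : ℂ) else 0 := fun e he => by
    split_ifs with h
    · simp [h]
    · exact sum_zpow_mul_primitiveRoot hω _ fun hd => h (Int.eq_zero_of_abs_lt_dvd hd he)
  set S := ∑ k ∈ Finset.range N, (chebPoly q).eval (((ρ : ℂ) * ω ^ k + ((ρ : ℂ) * ω ^ k)⁻¹) / 2)
    * ((ρ : ℂ) * ω ^ k) ^ (-(j : ℤ)) with hS
  have h1 : S = ∑ m : Fin (n + 1), q m / 2 *
      ((if (m : ℤ) - j = 0 then (N : ℂ) else 0) + if -(m : ℤ) - j = 0 then (N : ℂ) else 0) := by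
    have hm : ∀ m : Fin (n + 1), |(m : ℤ) - j| < N ∧ |-(m : ℤ) - j| < N := fun m => by
      constructor <;> rw [abs_lt] <;> constructor <;> omega
    simp only [hS, eval_chebPoly, Finset.sum_mul]
    rw [Finset.sum_comm]
    refine Finset.sum_congr rfl fun m _ => ?_
    rw [← hsum _ (hm m).1, ← hsum _ (hm m).2, ← Finset.sum_add_distrib, Finset.mul_sum]
    refine Finset.sum_congr rfl fun k _ => ?_
    rw [eval_T_joukowski (hz0 k), sub_eq_add_neg, sub_eq_add_neg, zpow_add₀ (hz0 k),
      zpow_add₀ (hz0 k)]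
    ring
  have h2 : S = q j / 2 * ((N : ℂ) + if -(j : ℤ) - j = 0 then (N : ℂ) else 0) := by
    rw [h1, Finset.sum_eq_single j]
    · simp
    · intro m _ hm
      have hmj : (m : ℕ) ≠ j := fun h => hm (Fin.ext h)
      rw [if_neg (by omega), if_neg (by omega)]
      simp
    · simp
  have h3 : ‖S‖ ≤ N * B := by
    refine (norm_sum_le _ _).trans ?_
    calc _ ≤ ∑ _k ∈ Finset.range N, B := by
          gcongr with k
          rw [norm_mul, zpow_neg, norm_inv, norm_zpow, hz, zpow_natCast]
          have h4 := hB _ (hz k)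
          have h5 : (ρ ^ (j : ℕ))⁻¹ ≤ 1 := inv_le_one_of_one_le₀ (one_le_pow₀ hρ)
          exact (mul_le_of_le_one_right (norm_nonneg _) h5).trans h4
      _ = N * B := by simp
  have hN0 : (0 : ℝ) < N := by rw [hN]; positivity
  -- For `j = 0` both exponentials of `T_0` contribute, and the factor is `2 N` instead of `N`.
  have h4 : (N : ℝ) ≤ ‖(N : ℂ) + if -(j : ℤ) - j = 0 then (N : ℂ) else 0‖ := by
    split_ifs
    · rw [← two_mul, norm_mul, Complex.norm_natCast, RCLike.norm_ofNat]
      linarith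
    · simp
  rw [h2, norm_mul, norm_div, RCLike.norm_ofNat] at h3
  have h5 : ‖q j‖ / 2 * N ≤ N * B := le_trans (by gcongr) h3
  nlinarith

end Ellipse

/-! ### Perturbation of the characteristic polynomial -/

section Perturbation

variable {n : ℕ}

/-- This identity makes the determinant affine in the rank-one part, so the large vector `V` enters
to the first power only. -/
theorem det_sub_mul_conjTranspose {X : Matrix (Fin n) (Fin n) ℂ} (hX : IsUnit X.det)
    (U V : Matrix (Fin n) (Fin 1) ℂ) :
    (X - U * Vᴴ).det = X.det * (1 - (Vᴴ * (X⁻¹ * U)) 0 0) := by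
  have h1 : X - U * Vᴴ = X * (1 - (X⁻¹ * U) * Vᴴ) := by
    rw [Matrix.mul_sub, Matrix.mul_one, ← Matrix.mul_assoc,
      Matrix.mul_nonsing_inv_cancel_left _ _ hX]
  rw [h1, Matrix.det_mul, Matrix.det_one_sub_mul_comm, Matrix.det_fin_one]
  rfl

/-- Perturbation of the determinant of a matrix plus a rank-one matrix. -/
theorem norm_det_perturbation_le {X E : Matrix (Fin n) (Fin n) ℂ}
    {U U' V V' : Matrix (Fin n) (Fin 1) ℂ} {d α β γ P : ℝ} (hX : BoundedBelow d X) (hd : 0 < d)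
    (hE : ‖E‖ ≤ γ) (hγ : γ ≤ d / 2) (hγ' : n ^ 2 * (γ / d) ≤ 1) (_hP : 0 ≤ P) (hU : ‖U‖ ≤ 1)
    (hU' : ‖U'‖ ≤ 2) (hV : ‖V‖ ≤ P) (hV' : ‖V'‖ ≤ 2 * P) (hα : ‖U' - U‖ ≤ α)
    (hβ : ‖V' - V‖ ≤ β) :
    ‖(X - E - U' * V'ᴴ).det - X.det * (1 - (Vᴴ * (X⁻¹ * U)) 0 0)‖
      ≤ ‖X.det‖ * (2 * n ^ 2 * (γ / d) * (1 + 8 * P / d)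
        + (4 * β / d + 2 * P * α / d + 2 * P * γ / d ^ 2)) := by
  have hγ0 : 0 ≤ γ := (norm_nonneg _).trans hE
  have hα0 : 0 ≤ α := (norm_nonneg _).trans hα
  have hβ0 : 0 ≤ β := (norm_nonneg _).trans hβ
  have hXE : BoundedBelow (d / 2) (X - E) := fun q Y =>
    le_trans (by gcongr; linarith) (hX.sub hE q Y)
  have hXu := hX.isUnit_det hd
  have hXEu := hXE.isUnit_det (half_pos hd)
  set Y := X - E with hY
  have hdet : Y.det = X.det * (1 - X⁻¹ * E).det := by
    rw [← Matrix.det_mul, Matrix.mul_sub, Matrix.mul_one,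
      Matrix.mul_nonsing_inv_cancel_left _ _ hXu]
  have hD : ‖(1 - X⁻¹ * E).det - 1‖ ≤ 2 * n ^ 2 * (γ / d) :=
    norm_det_one_sub_sub_one_le_of_small ((hX.norm_inv_mul_le hd E).trans (by gcongr)) hγ'
  have inv_le : ∀ {W : Matrix (Fin n) (Fin 1) ℂ} {w : ℝ}, ‖W‖ ≤ w → ‖Y⁻¹ * W‖ ≤ 2 * w / d := by
    intro W w hW
    refine (hXE.norm_inv_mul_le (half_pos hd) W).trans ?_
    calc ‖W‖ / (d / 2) = 2 * ‖W‖ / d := by field_simp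
      _ ≤ _ := by gcongr
  have pair_le : ∀ {A B : Matrix (Fin n) (Fin 1) ℂ} {a b : ℝ}, ‖A‖ ≤ a → ‖B‖ ≤ b →
      ‖(Aᴴ * B) 0 0‖ ≤ a * b := by
    intro A B a b hA hB
    refine (norm_entry_le _ 0 0).trans ((Matrix.frobenius_norm_mul _ _).trans ?_)
    rw [Matrix.frobenius_norm_conjTranspose]
    exact mul_le_mul hA hB (norm_nonneg _) ((norm_nonneg _).trans hA)
  set s := (Vᴴ * (X⁻¹ * U)) 0 0 with hs
  set s' := (V'ᴴ * (Y⁻¹ * U')) 0 0 with hs'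
  have hs'n : ‖s'‖ ≤ 8 * P / d := by
    refine (pair_le hV' (inv_le hU')).trans (le_of_eq ?_)
    ring
  have hEXU : ‖E * (X⁻¹ * U)‖ ≤ γ * (1 / d) := by
    refine (Matrix.frobenius_norm_mul _ _).trans ?_
    have := (hX.norm_inv_mul_le hd U).trans (div_le_div_of_nonneg_right hU hd.le)
    gcongr
  -- Telescoping over the three perturbed ingredients `V`, `U` and the resolvent, the last by the
  -- resolvent identity.
  have hdiff : s' - s = ((V' - V)ᴴ * (Y⁻¹ * U')) 0 0 + (Vᴴ * (Y⁻¹ * (U' - U))) 0 0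
      + (Vᴴ * (Y⁻¹ * (E * (X⁻¹ * U)))) 0 0 := by
    have e1 : Y⁻¹ * (E * (X⁻¹ * U)) = Y⁻¹ * U - X⁻¹ * U := by
      have : E = X - Y := by rw [hY]; abel
      rw [this, Matrix.sub_mul, Matrix.mul_sub, Matrix.mul_nonsing_inv_cancel_left _ _ hXu,
        Matrix.nonsing_inv_mul_cancel_left _ _ hXEu]
    rw [e1, hs, hs']
    simp only [Matrix.conjTranspose_sub, Matrix.sub_mul, Matrix.mul_sub, Matrix.sub_apply]
    ring
  have hsd : ‖s' - s‖ ≤ 4 * β / d + 2 * P * α / d + 2 * P * γ / d ^ 2 := by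
    rw [hdiff]
    refine (norm_add_le _ _).trans (add_le_add ((norm_add_le _ _).trans (add_le_add ?_ ?_)) ?_)
    · exact (pair_le hβ (inv_le hU')).trans (le_of_eq (by ring))
    · exact (pair_le hV (inv_le hα)).trans (le_of_eq (by ring))
    · exact (pair_le hV (inv_le hEXU)).trans (le_of_eq (by field_simp))
  -- The factor `X.det` is taken out, so that all remaining errors are relative to it; on the
  -- ellipse it is controlled by `T_n`.
  have e2 : (Y - U' * V'ᴴ).det - X.det * (1 - s)
      = X.det * (((1 - X⁻¹ * E).det - 1) * (1 - s') - (s' - s)) := by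
    rw [det_sub_mul_conjTranspose hXEu, hdet]
    ring
  rw [e2, norm_mul]
  gcongr
  refine (norm_sub_le _ _).trans (add_le_add ?_ hsd)
  rw [norm_mul]
  have h1 : ‖1 - s'‖ ≤ 1 + 8 * P / d := by
    have := norm_sub_le (1 : ℂ) s'
    rw [norm_one] at this
    linarith
  exact mul_le_mul hD h1 (norm_nonneg _) (by positivity)

/-- On the ellipse with the parameter `1 + 1 / n`, a perturbation of the data of the colleague
matrix changes the characteristic polynomial by a polynomial in `n` times the perturbation. -/
theorem norm_charpoly_perturbation_le (hn : 2 ≤ n) {p : EuclideanSpace ℂ (Fin (n + 1))}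
    (hp : p (Fin.last n) = 1) {E : Matrix (Fin n) (Fin n) ℂ} {U V : Matrix (Fin n) (Fin 1) ℂ}
    {α β γ P : ℝ} (hP : 1 ≤ P) (hv : ‖column (colleagueV p)‖ ≤ P) (hE : ‖E‖ ≤ γ)
    (hγ : 8 * n ^ 4 * γ ≤ 1) (hU : ‖U - column (colleagueU n)‖ ≤ α)
    (hV : ‖V - column (colleagueV p)‖ ≤ β) (hα : α ≤ 1) (hβ : β ≤ P) {z : ℂ}
    (hz : ‖z‖ = 1 + 1 / (n : ℝ)) :
    ‖2 ^ (n - 1) * (Matrix.scalar (Fin n) ((z + z⁻¹) / 2) - colleagueF n - E - U * Vᴴ).det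
        - (chebPoly p).eval ((z + z⁻¹) / 2)‖ ≤ 900 * n ^ 6 * (P * γ + β + P * α) := by
  have hγ0 : 0 ≤ γ := (norm_nonneg _).trans hE
  have hα0 : 0 ≤ α := (norm_nonneg _).trans hU
  have hβ0 : 0 ≤ β := (norm_nonneg _).trans hV
  have hn' : (1 : ℝ) ≤ n := by exact_mod_cast (by omega : 1 ≤ n)
  have hn0 : (0 : ℝ) < n := by linarith
  set x := (z + z⁻¹) / 2
  -- The distance `η² / 4` with `η = 1 / n`.
  set d : ℝ := 1 / (4 * n ^ 2) with hd
  have hd0 : 0 < d := by positivity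
  have hX : BoundedBelow d (Matrix.scalar (Fin n) x - colleagueF n) := by
    refine colleagueF_boundedBelow hn fun t ht => ?_
    refine le_trans (le_of_eq ?_) (le_norm_joukowski_sub (η := 1 / n) (by positivity)
      (by rw [div_le_one hn0]; exact hn') hz ht)
    rw [hd]; field_simp
  have hdiv : ∀ a : ℝ, a / d = 4 * n ^ 2 * a := fun a => by rw [hd]; field_simp
  have hdiv2 : ∀ a : ℝ, a / d ^ 2 = 16 * n ^ 4 * a := fun a => by rw [hd]; field_simp; norm_num
  have pw : ∀ {i j : ℕ}, i ≤ j → (n : ℝ) ^ i ≤ n ^ j := fun h => pow_le_pow_right₀ hn' h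
  have hγd : γ ≤ d / 2 := by
    have : 8 * (n : ℝ) ^ 2 * γ ≤ 8 * n ^ 4 * γ := by
      gcongr 8 * ?_ * γ
      exact pw (by norm_num)
    rw [hd, div_div, le_div_iff₀ (by positivity)]
    linarith
  have hγ' : (n : ℝ) ^ 2 * (γ / d) ≤ 1 := by
    rw [hdiv]
    have : 0 ≤ (n : ℝ) ^ 4 * γ := by positivity
    linarith
  have hu := norm_column_colleagueU_le (n := n)
  have hU' : ‖U‖ ≤ 2 := by
    have := norm_le_norm_add_norm_sub' U (column (colleagueU n))
    linarith
  have hV' : ‖V‖ ≤ 2 * P := by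
    have := norm_le_norm_add_norm_sub' V (column (colleagueV p))
    linarith
  have h1 := norm_det_perturbation_le hX hd0 hE hγd hγ' (by linarith) hu hU' hv hV' hU hV
  rw [eval_chebPoly_eq hn p hp (hX.isUnit_det hd0), ← two_pow_mul_det_scalar_sub_colleagueF hn x,
    mul_assoc, ← mul_sub, norm_mul]
  have h2 : ‖(2 : ℂ) ^ (n - 1)‖ * ‖(Matrix.scalar (Fin n) x - colleagueF n).det‖ ≤ 3 := by
    rw [← norm_mul, two_pow_mul_det_scalar_sub_colleagueF hn x]
    exact norm_eval_T_joukowski_le (by omega) hz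
  have h3 := mul_le_mul_of_nonneg_left h1 (norm_nonneg ((2 : ℂ) ^ (n - 1)))
  rw [← mul_assoc] at h3
  simp only [hdiv, hdiv2] at h3
  refine h3.trans ?_
  -- The largest power `n ^ 6` comes from the product of the determinant error of order `n ^ 4 * γ`
  -- and the resolvent term of order `n ^ 2 * P`.
  have h4 : 2 * (n : ℝ) ^ 2 * (4 * n ^ 2 * γ) * (1 + 4 * n ^ 2 * (8 * P))
      + (4 * n ^ 2 * (4 * β) + 4 * n ^ 2 * (2 * P * α) + 16 * n ^ 4 * (2 * P * γ))
      ≤ 300 * n ^ 6 * (P * γ + β + P * α) := by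
    have hPγ : 0 ≤ P * γ := by positivity
    have hPα : 0 ≤ P * α := by positivity
    have t1 : (n : ℝ) ^ 4 * γ ≤ n ^ 6 * (P * γ) :=
      mul_le_mul (pw (by norm_num)) (le_mul_of_one_le_left hγ0 hP) hγ0 (by positivity)
    have t2 : (n : ℝ) ^ 4 * (P * γ) ≤ n ^ 6 * (P * γ) := by
      gcongr ?_ * _
      exact pw (by norm_num)
    have t3 : (n : ℝ) ^ 2 * β ≤ n ^ 6 * β := by
      gcongr ?_ * _
      exact pw (by norm_num)
    have t4 : (n : ℝ) ^ 2 * (P * α) ≤ n ^ 6 * (P * α) := by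
      gcongr ?_ * _
      exact pw (by norm_num)
    have t5 : 0 ≤ (n : ℝ) ^ 6 * β := by positivity
    have t6 : 0 ≤ (n : ℝ) ^ 6 * (P * α) := by positivity
    have e : 2 * (n : ℝ) ^ 2 * (4 * n ^ 2 * γ) * (1 + 4 * n ^ 2 * (8 * P))
      + (4 * n ^ 2 * (4 * β) + 4 * n ^ 2 * (2 * P * α) + 16 * n ^ 4 * (2 * P * γ))
      = 8 * (n ^ 4 * γ) + 256 * (n ^ 6 * (P * γ)) + (16 * (n ^ 2 * β) + 8 * (n ^ 2 * (P * α))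
        + 32 * (n ^ 4 * (P * γ))) := by ring
    have e' : 300 * (n : ℝ) ^ 6 * (P * γ + β + P * α)
      = 300 * (n ^ 6 * (P * γ)) + 300 * (n ^ 6 * β) + 300 * (n ^ 6 * (P * α)) := by ring
    have t7 : 0 ≤ (n : ℝ) ^ 6 * (P * γ) := by positivity
    rw [e, e']
    linarith
  calc _ ≤ 3 * (300 * n ^ 6 * (P * γ + β + P * α)) := by
        gcongr
    _ = _ := by ring

end Perturbation

/-! ### Chebyshev expansions with prescribed leading coefficient -/

section Expansion

theorem exists_chebyshev_expansion (m : ℕ) (h : Polynomial ℂ) (hh : h.degree < m) :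
    ∃ c : Fin m → ℂ,
      h = ∑ j, Polynomial.C (c j) * Polynomial.Chebyshev.T ℂ ((j : ℕ) : ℤ) := by
  induction m generalizing h with
  | zero => exact ⟨fun j => j.elim0, by simpa using hh⟩
  | succ m ih =>
    set t := (Polynomial.Chebyshev.T ℂ (m : ℤ)) with ht
    have htd : t.natDegree = m := by simp [ht]
    have htc : t.coeff m ≠ 0 := by
      have h0 : t.leadingCoeff ≠ 0 := by
        rw [ht, Polynomial.Chebyshev.leadingCoeff_T]
        exact pow_ne_zero _ two_ne_zero
      rwa [Polynomial.leadingCoeff, htd] at h0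
    set a := h.coeff m / t.coeff m
    obtain ⟨c, hc⟩ := ih (h - Polynomial.C a * t) (by
      rw [Polynomial.degree_lt_iff_coeff_zero] at hh ⊢
      intro k hk
      rw [Polynomial.coeff_sub, Polynomial.coeff_C_mul]
      rcases hk.eq_or_lt with rfl | hk
      · rw [div_mul_cancel₀ _ htc, sub_self]
      · rw [hh k hk, Polynomial.coeff_eq_zero_of_natDegree_lt (by omega), mul_zero, sub_zero])
    refine ⟨Fin.snoc c a, ?_⟩
    rw [Fin.sum_univ_castSucc]
    simp only [Fin.snoc_castSucc, Fin.snoc_last, Fin.val_castSucc, Fin.val_last]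
    rw [← hc, ← ht]
    ring

theorem chebPoly_add {n : ℕ} (p q : EuclideanSpace ℂ (Fin (n + 1))) :
    chebPoly (p + q) = chebPoly p + chebPoly q := by
  simp [chebPoly, add_mul, Finset.sum_add_distrib]

/-- A polynomial with the leading coefficient of `T n` is monic in the Chebyshev basis. -/
theorem exists_chebPoly_add_eq {n : ℕ} (hn : 1 ≤ n) {p : EuclideanSpace ℂ (Fin (n + 1))}
    (hp : p (Fin.last n) = 1) {g : Polynomial ℂ} (hg : g.natDegree = n)
    (hg' : g.leadingCoeff = 2 ^ (n - 1)) :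
    ∃ δp : EuclideanSpace ℂ (Fin (n + 1)), δp (Fin.last n) = 0 ∧ chebPoly (p + δp) = g := by
  set t := (Polynomial.Chebyshev.T ℂ (n : ℤ)) with ht
  have htd : t.natDegree = n := by simp [ht]
  have htl : t.leadingCoeff = 2 ^ (n - 1) := by
    rw [ht, Polynomial.Chebyshev.leadingCoeff_T]; simp
  have hr : chebPoly p = (∑ j : Fin n, Polynomial.C (p j.castSucc) *
      Polynomial.Chebyshev.T ℂ ((j : ℕ) : ℤ)) + t := by
    rw [chebPoly, Fin.sum_univ_castSucc, hp]
    simp [ht]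
  have hgt : (g - t).degree < n := by
    have hg0 : g ≠ 0 := by
      intro h
      rw [h, Polynomial.natDegree_zero] at hg
      omega
    have ht0 : t ≠ 0 := by
      intro h
      rw [h, Polynomial.natDegree_zero] at htd
      omega
    have h1 := Polynomial.degree_sub_lt_left (p := g) (q := t)
      (by rw [Polynomial.degree_eq_natDegree hg0, Polynomial.degree_eq_natDegree ht0, hg, htd]) hg0
      (by rw [hg', htl])
    rwa [Polynomial.degree_eq_natDegree hg0, hg] at h1
  obtain ⟨c, hc⟩ := exists_chebyshev_expansion n (g - t) hgt
  refine ⟨WithLp.toLp 2 (Fin.snoc (fun j => c j - p j.castSucc) 0), by simp, ?_⟩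
  have h1 : g = (g - t) + t := by ring
  rw [chebPoly_add, hr, h1, hc, chebPoly, Fin.sum_univ_castSucc]
  simp only [Fin.snoc_castSucc, Fin.snoc_last, Fin.val_castSucc, Polynomial.C_sub, sub_mul,
    Finset.sum_sub_distrib, Polynomial.C_0, zero_mul, add_zero]
  ring

theorem norm_le_of_apply_le {n : ℕ} {q : EuclideanSpace ℂ (Fin (n + 1))} {B : ℝ}
    (hB : 0 ≤ B) (h : ∀ j, ‖q j‖ ≤ B) : ‖q‖ ≤ (n + 1) * B := by
  refine abs_le_of_sq_le_sq' ?_ (by positivity) |>.2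
  rw [EuclideanSpace.norm_sq_eq]
  calc ∑ j, ‖q j‖ ^ 2 ≤ ∑ _j : Fin (n + 1), B ^ 2 := by gcongr; exact h _
    _ = (n + 1) * B ^ 2 := by simp
    _ ≤ _ := by
      rw [mul_pow]
      gcongr
      exact le_self_pow₀ (by linarith [(Nat.cast_nonneg n : (0 : ℝ) ≤ n)]) two_ne_zero

end Expansion

/-! ### From the converged state to the perturbed polynomial -/

section Eigenvalues

variable {n : ℕ}

theorem State.Converged.det_scalar_sub_matrix {S : State n} (hS : S.Converged) (x : ℂ) :
    (Matrix.scalar (Fin n) x - S.matrix).det = ∏ i, (x - S.L i i) := by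
  rw [Matrix.det_of_isUpperTriangular]
  · refine Finset.prod_congr rfl fun i _ => ?_
    rw [Matrix.sub_apply, S.matrix_of_le le_rfl]
    simp
  · intro i j hij
    have hij' : j < i := hij
    rw [Matrix.sub_apply, S.matrix_of_le hij'.le, hS i j hij', Matrix.scalar_apply,
      Matrix.diagonal_apply_ne _ hij'.ne', sub_zero]

/-- The Schur form which tracks `F, u₀, v₀` has the characteristic polynomial of a perturbation of
`F + u₀ v₀^*`. -/
theorem State.Tracks.exists_perturbation {F Q : Matrix (Fin n) (Fin n) ℂ} {u₀ v₀ : Fin n → ℂ}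
    {α β κ γ : ℝ} {S : State n} (hS : S.Tracks F u₀ v₀ α β κ γ Q) :
    ∃ (E : Matrix (Fin n) (Fin n) ℂ) (U V : Matrix (Fin n) (Fin 1) ℂ),
      ‖E‖ ≤ γ ∧ ‖U - column u₀‖ ≤ α ∧ ‖V - column v₀‖ ≤ β ∧
      ∀ x : ℂ, (Matrix.scalar (Fin n) x - S.matrix).det
        = (Matrix.scalar (Fin n) x - F - E - U * Vᴴ).det := by
  have hQ := hS.unitary
  have hQ' : Q * Qᴴ = 1 := mul_eq_one_comm.mp hQ
  have hvec : ∀ {w w₀ : Fin n → ℂ} {a : ℝ}, ‖column w - Qᴴ * column w₀‖ ≤ a →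
      ‖Q * column w - column w₀‖ ≤ a := fun {w w₀ a} h => by
    rw [← norm_conjTranspose_mul_of_unitary hQ, Matrix.mul_sub, ← Matrix.mul_assoc, hQ,
      Matrix.one_mul]
    exact h
  -- The computed form is conjugated back by the accumulated unitary `Q`, which turns the forward
  -- errors into perturbations of the original data with the same norms.
  refine ⟨Q * S.herm * Qᴴ - F, Q * column S.u, Q * column S.v, ?_, hvec hS.u, hvec hS.v,
    fun x => ?_⟩
  · rw [← norm_unitary_similarity hQ]
    have e : Qᴴ * (Q * S.herm * Qᴴ - F) * Q = S.herm - Qᴴ * F * Q := by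
      rw [Matrix.mul_sub, Matrix.sub_mul]
      simp only [← Matrix.mul_assoc, hQ, Matrix.one_mul]
      rw [Matrix.mul_assoc, hQ, Matrix.mul_one]
    rw [e]
    exact hS.herm
  · have e1 : S.matrix = S.herm + column S.u * (column S.v)ᴴ := by simp [State.herm]
    have e2 : Matrix.scalar (Fin n) x - F - (Q * S.herm * Qᴴ - F)
        - (Q * column S.u) * (Q * column S.v)ᴴ
        = Q * (Matrix.scalar (Fin n) x - S.matrix) * Qᴴ := by
      have e3 : Q * Matrix.scalar (Fin n) x * Qᴴ = Matrix.scalar (Fin n) x := by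
        rw [Matrix.scalar_apply, ← Matrix.smul_one_eq_diagonal, Matrix.mul_smul, Matrix.mul_one,
          Matrix.smul_mul, hQ']
      rw [Matrix.mul_sub, Matrix.sub_mul, e3, e1, Matrix.mul_add, Matrix.add_mul,
        Matrix.conjTranspose_mul]
      simp only [Matrix.mul_assoc]
      abel
    rw [e2, Matrix.det_mul, Matrix.det_mul, mul_right_comm, ← Matrix.det_mul, hQ', Matrix.det_one,
      one_mul]

theorem State.TracksAfter.exists_chebPoly_roots_eq (hn : 2 ≤ n)
    {p : EuclideanSpace ℂ (Fin (n + 1))} (hp : p (Fin.last n) = 1) {P δ : ℝ} (hδ : 0 ≤ δ)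
    (hP : 1 ≤ P) (hv : ‖column (colleagueV p)‖ ≤ P) {N : ℕ} {S : State n}
    (hS : S.TracksAfter (colleagueF n) (colleagueU n) (colleagueV p) P δ N) (hN1 : 1 ≤ N)
    (hN : 640 * n ^ 7 * N ^ 2 * P * δ ≤ 1) (hc : S.Converged) :
    ∃ δp : EuclideanSpace ℂ (Fin (n + 1)), δp (Fin.last n) = 0 ∧
      (chebPoly (p + δp)).roots = S.eigenvalues ∧
      ‖δp‖ ≤ 360000 * n ^ 10 * N ^ 2 * P ^ 2 * δ := by
  obtain ⟨Q, hQ⟩ := hS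
  obtain ⟨E, U, V, hE, hU, hV, hdet⟩ := hQ.exists_perturbation
  have hn' : (1 : ℝ) ≤ n := by exact_mod_cast (by omega : 1 ≤ n)
  have hN' : (1 : ℝ) ≤ N := by exact_mod_cast hN1
  have pw : ∀ {i j : ℕ}, i ≤ j → (n : ℝ) ^ i ≤ n ^ j := fun h => pow_le_pow_right₀ hn' h
  set D := (N : ℝ) ^ 2 * P * δ with hD
  have hD0 : 0 ≤ D := by positivity
  have hNδ : (N : ℝ) * δ ≤ D := by
    rw [hD]
    have h1 : (N : ℝ) * δ * 1 ≤ N ^ 2 * δ * P := by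
      gcongr
      exact le_self_pow₀ hN' two_ne_zero
    linarith
  have hNPδ : (N : ℝ) * P * δ ≤ D := by
    rw [hD]
    gcongr
    exact le_self_pow₀ hN' two_ne_zero
  have hα : 2 * N * n * δ ≤ 2 * n ^ 3 * D := by
    have : (n : ℝ) ^ 1 * (N * δ) ≤ n ^ 3 * D := by
      gcongr ?_ * ?_
      · exact pw (by norm_num)
    linarith
  have hβ : 2 * N * n * P * δ ≤ 2 * n ^ 3 * D := by
    have : (n : ℝ) ^ 1 * (N * P * δ) ≤ n ^ 3 * D := by
      gcongr ?_ * ?_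
      · exact pw (by norm_num)
    linarith
  have hγ : (N : ℝ) ^ 2 * stepError n P δ = 80 * n ^ 3 * D := by
    rw [stepError, hD]; ring
  have hN7 : 640 * (n : ℝ) ^ 7 * D ≤ 1 := by rw [hD]; linarith
  have h37 : (n : ℝ) ^ 3 * D ≤ n ^ 7 * D := by
    gcongr ?_ * _
    exact pw (by norm_num)
  have h3D : 2 * (n : ℝ) ^ 3 * D ≤ 1 := by
    have : 0 ≤ (n : ℝ) ^ 7 * D := by positivity
    linarith
  -- The polynomial with the computed eigenvalues as roots, normalized to the leading coefficient of
  -- `T_n`.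
  set g := Polynomial.C ((2 : ℂ) ^ (n - 1)) *
    (S.eigenvalues.map fun a => Polynomial.X - Polynomial.C a).prod with hg
  have hcard : S.eigenvalues.card = n := by simp [State.eigenvalues]
  have h2 : (2 : ℂ) ^ (n - 1) ≠ 0 := pow_ne_zero _ two_ne_zero
  have hgd : g.natDegree = n := by
    rw [hg, Polynomial.natDegree_C_mul h2, Polynomial.natDegree_multiset_prod_X_sub_C_eq_card,
      hcard]
  have hgl : g.leadingCoeff = 2 ^ (n - 1) := by
    rw [hg, Polynomial.leadingCoeff_mul, Polynomial.leadingCoeff_C,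
      (Polynomial.monic_multiset_prod_of_monic _ _ fun a _ =>
        Polynomial.monic_X_sub_C a).leadingCoeff, mul_one]
  have hge : ∀ x, g.eval x = 2 ^ (n - 1) *
      (Matrix.scalar (Fin n) x - colleagueF n - E - U * Vᴴ).det := fun x => by
    rw [← hdet, hc.det_scalar_sub_matrix, hg, Polynomial.eval_mul, Polynomial.eval_C,
      Polynomial.eval_multiset_prod, Multiset.map_map, State.eigenvalues, Multiset.map_map]
    simp only [Function.comp_def, Polynomial.eval_sub, Polynomial.eval_X, Polynomial.eval_C]
    rfl
  obtain ⟨δp, hδp, hpg⟩ := exists_chebPoly_add_eq (by omega) hp hgd hgl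
  refine ⟨δp, hδp, ?_, ?_⟩
  · rw [hpg, hg, Polynomial.roots_C_mul _ h2, Polynomial.roots_multiset_prod_X_sub_C]
  · have hval : ∀ z : ℂ, ‖z‖ = 1 + 1 / (n : ℝ) →
        ‖(chebPoly δp).eval ((z + z⁻¹) / 2)‖
          ≤ 900 * n ^ 6 * (P * (80 * n ^ 3 * D) + 2 * n ^ 3 * D + P * (2 * n ^ 3 * D)) := by
      intro z hz
      have e : (chebPoly δp).eval ((z + z⁻¹) / 2)
          = g.eval ((z + z⁻¹) / 2) - (chebPoly p).eval ((z + z⁻¹) / 2) := by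
        rw [← hpg, chebPoly_add, Polynomial.eval_add]; ring
      rw [e, hge]
      -- With `γ = 80 * n ^ 3 * D`, the requirement `8 * n ^ 4 * γ ≤ 1` is exactly the assumption
      -- with the constant 640 and the power `n ^ 7`.
      exact norm_charpoly_perturbation_le hn hp hP hv (hE.trans hγ.le) (by linarith)
        (hU.trans hα) (hV.trans hβ) h3D (by linarith) hz
    have hcoef := norm_apply_le_of_eval_joukowski δp
      (by linarith [show 0 ≤ 1 / (n : ℝ) by positivity]) hval
    refine (norm_le_of_apply_le (by positivity) hcoef).trans ?_
    have h1 : (n : ℝ) ^ 3 * D ≤ n ^ 3 * D * P := le_mul_of_one_le_right (by positivity) hP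
    -- The three error terms sum to at most `84 * n ^ 3 * D * P`, rounded up to 100. One factor `P`
    -- is inside `D`, the other comes from the perturbation bound.
    calc ((n : ℝ) + 1) * (2 * (900 * n ^ 6 * (P * (80 * n ^ 3 * D) + 2 * n ^ 3 * D
          + P * (2 * n ^ 3 * D))))
        ≤ (2 * n) * (2 * (900 * n ^ 6 * (100 * (n ^ 3 * D * P)))) := by
          have h0 : 0 ≤ (n : ℝ) ^ 3 * D * P := by positivity
          gcongr
          · linarith
          · linarith
      _ = 360000 * n ^ 10 * N ^ 2 * P ^ 2 * δ := by rw [hD]; ring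

end Eigenvalues

end StructuredQR

/-! ### Choice of the constants -/

theorem theorem3p3 (a : ℕ) :
    ∃ k : ℕ, ∀ (K : ℕ) (τ : ℝ), ∃ C : ℝ, 0 < C ∧
      ∀ (n : ℕ), 2 ≤ n →
      ∀ (p : EuclideanSpace ℂ (Fin (n + 1))), p (Fin.last n) = 1 →
      ∀ (ε : ℝ) (fl : ℝ → ℝ), StructuredQR.StandardModel ε fl →
      C * (n : ℝ) ^ k * ‖p‖ * ε ≤ 1 →
      ∀ (N : ℕ) (S₀ S : StructuredQR.State n),
        S₀.Represents τ ε p →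
        StructuredQR.Run τ ε fl N S₀ S →
        N ≤ K * n ^ a →
        S.Converged →
        ∃ δp : EuclideanSpace ℂ (Fin (n + 1)),
          δp (Fin.last n) = 0 ∧
          (StructuredQR.chebPoly (p + δp)).roots = S.eigenvalues ∧
          ‖δp‖ ≤ C * (n : ℝ) ^ k * ‖p‖ ^ 2 * ε := by
  -- The power `n ^ 10` is that of the bound on `δp`; the remaining `n ^ (2 * a)` and the factor `(K
  -- + 1) ^ 2` bound the square of the number of operations plus one, and `8000 + |τ|` is the error
  -- of one operation.
  refine ⟨2 * a + 10, fun K τ => ⟨360000 * (K + 1) ^ 2 * (8000 + |τ|), by positivity, ?_⟩⟩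
  intro n hn p hp ε fl hfl hε N S₀ S hS₀ hR hN hc
  have h0 := hfl.nonneg
  have hn' : (1 : ℝ) ≤ n := by exact_mod_cast (by omega : 1 ≤ n)
  have pw : ∀ {i j : ℕ}, i ≤ j → (n : ℝ) ^ i ≤ n ^ j := fun h => pow_le_pow_right₀ hn' h
  have hP : 1 ≤ ‖p‖ := by
    have := PiLp.norm_apply_le p (Fin.last n)
    rwa [hp, norm_one] at this
  set P := ‖p‖ with hPdef
  have hN1 : (N : ℝ) + 1 ≤ (K + 1) * n ^ a := by
    have h1 : (N : ℝ) ≤ K * n ^ a := by exact_mod_cast hN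
    have h2 : (1 : ℝ) ≤ (n : ℝ) ^ a := one_le_pow₀ hn'
    linarith
  have hN2 : ((N : ℝ) + 1) ^ 2 ≤ (K + 1) ^ 2 * n ^ (2 * a) := by
    calc ((N : ℝ) + 1) ^ 2 ≤ ((K + 1) * n ^ a) ^ 2 := by gcongr
      _ = _ := by rw [mul_pow, ← pow_mul, mul_comm a]
  set δ := (8000 + |τ|) * ε with hδdef
  have hδ : 0 ≤ δ := by positivity
  have key : ∀ m ≤ 10, (n : ℝ) ^ m * ((N : ℝ) + 1) ^ 2 * δ
      ≤ (K + 1) ^ 2 * n ^ (2 * a + 10) * δ := fun m hm => by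
    calc (n : ℝ) ^ m * ((N : ℝ) + 1) ^ 2 * δ
        ≤ n ^ 10 * ((K + 1) ^ 2 * n ^ (2 * a)) * δ := by
          gcongr ?_ * ?_ * δ
          exact pw hm
      _ = _ := by ring
  -- All smallness conditions used along the way follow from the single assumption on `ε`, with
  -- various powers `m` of `n`.
  have hsmall : ∀ m ≤ 10, 360000 * ((n : ℝ) ^ m * ((N : ℝ) + 1) ^ 2 * P * δ) ≤ 1 := fun m hm => by
    have h1 := mul_le_mul_of_nonneg_left (key m hm) (by linarith : 0 ≤ P)
    have h2 : 360000 * (P * ((K + 1) ^ 2 * n ^ (2 * a + 10) * δ)) ≤ 1 := by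
      refine le_trans (le_of_eq ?_) hε
      rw [hδdef]; ring
    linarith
  have hnonneg : ∀ m : ℕ, 0 ≤ (n : ℝ) ^ m * ((N : ℝ) + 1) ^ 2 * P * δ := fun m => by positivity
  have hE1 : ((N : ℝ) + 1) ^ 2 * StructuredQR.stepError n P δ ≤ 1 := by
    have h1 := hsmall 3 (by norm_num)
    have h2 := hnonneg 3
    unfold StructuredQR.stepError
    linarith
  have hE2 : StructuredQR.stepError n P δ ≤ 1 := by
    have h1 : 0 ≤ StructuredQR.stepError n P δ := by unfold StructuredQR.stepError; positivity
    refine le_trans (le_mul_of_one_le_left h1 ?_) hE1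
    exact one_le_pow₀ (by linarith [(Nat.cast_nonneg N : (0 : ℝ) ≤ N)])
  have hε1 : ε ≤ 1 / 100 := by
    have h1 := hsmall 0 (by norm_num)
    have h2 : 1 * 1 * δ ≤ ((N : ℝ) + 1) ^ 2 * P * δ := by
      gcongr
      exact one_le_pow₀ (by linarith [(Nat.cast_nonneg N : (0 : ℝ) ≤ N)])
    have h3 : 0 ≤ |τ| * ε := by positivity
    rw [hδdef] at h1 h2
    linarith
  have hv := StructuredQR.norm_column_colleagueV_le p hp
  have hT := hR.tracksAfter hfl hε1 (by omega) hP StructuredQR.norm_colleagueF_le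
    StructuredQR.norm_column_colleagueU_le hv (hS₀.tracksAfter h0 (by omega) hP hv hE2) hE1
  obtain ⟨δp, h1, h2, h3⟩ := hT.exists_chebPoly_roots_eq hn hp hδ hP hv (by omega)
    (by
      have h1 := hsmall 7 (by norm_num)
      have h2 := hnonneg 7
      push_cast
      linarith) hc
  refine ⟨δp, h1, h2, h3.trans ?_⟩
  have h4 := mul_le_mul_of_nonneg_left (key 10 le_rfl) (by positivity : 0 ≤ 360000 * P ^ 2)
  push_cast
  rw [hδdef] at h4 ⊢
  linarith
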